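/- Let $d\ge 1$ and $I=[-1,1]$. For a finite Borel measure $\nu$ on $I^d$ with $\int R^2\,d\nu>0$ for every non-zero polynomial $R$, let $(\phi_k)_{k\ge0}$ be the orthonormal polynomials obtained by applying the Gram--Schmidt algorithm in $L^2(\nu)$ to the monomials $x_1^{\alpha_1}\cdots x_d^{\alpha_d}$, $\alpha\in\mathbb N^d$, enumerated increasingly for the graded lexicographic order: $\alpha<\beta$ iff $\max_j\alpha_j<\max_j\beta_j$, or $\max_j\alpha_j=\max_j\beta_j$ and $\alpha$ precedes $\beta$ in the usual lexicographic order. Set $K_N(x,y)=\sum_{k=0}^{N-1}\phi_k(x)\phi_k(y)$. The multivariate OP Ensemble with reference measure $\nu$ is the random vector $(\mathbf x_1,\ldots,\mathbf x_N)$ of points of $I^d$ with joint law $$\frac1{N!}\det\big[K_N(x_i,x_\ell)\big]_{i,\ell=1}^N\prod_{i=1}^N\nu(dx_i).$$ When $d=1$, the orthonormal polynomials satisfy $x\phi_k=a_k\phi_{k+1}+b_k\phi_k+a_{k-1}\phi_{k-1}$ with $a_{-1}=0$ and $a_k>0$, $b_k\in\mathbb R$ for $k\ge 0$; a measure on $I$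 with well-defined orthonormal polynomials is Nevai-class if $a_k\to\tfrac12$ and $b_k\to0$ as $k\to\infty$. Let $\mu_{eq}(dx)=\frac{1}{\pi\sqrt{1-x^2}}\mathbf 1_{I}(x)\,dx$. **Proposition.** Let $\mu=\mu_1\otimes\cdots\otimes\mu_d$, where the $\mu_j$ are Nevai-class probability measures on $I$. Let $\mathbf x_1,\ldots,\mathbf x_N$ and $\mathbf x_1^*,\ldots,\mathbf x_N^*$ be drawn from the multivariate OP Ensembles with respective reference measures $\mu$ and $\mu_{eq}^{\otimes d}$ (for every $N$ the two joint laws are probability measures, and the linear statistics below are square integrable). Then, for all polynomial functions $P,Q$ on $\mathbb R^d$, $$\lim_{N\to\infty}\frac1{N^{1-1/d}}\left|\,\mathbb C\mathrm{ov}\Big[\sum_{i=1}^NP(\mathbf x_i),\sum_{i=1}^NQ(\mathbf x_i)\Big]-\mathbb C\mathrm{ov}\Big[\sum_{i=1}^NP(\mathbf x_i^*),\sum_{i=1}^NQ(\mathbf x_i^*)\Big]\right|=0.$$ -/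

import Mathlib

open MeasureTheory ProbabilityTheory Filter Topology

/-- The multi-indices `ℕ^d`; a copy of `Fin d → ℕ` carrying the graded lexicographic order below. -/
def MultiIndex (d : ℕ) : Type := Fin d → ℕ

namespace MultiIndex

/-- The sup norm `max (α_1, …, α_d)` of a multi-index. -/
def maxNorm {d : ℕ} (α : MultiIndex d) : ℕ := Finset.univ.sup α

/-- The key by which multi-indices are sorted: first the sup norm, then the usual lexicographic
order. -/
def key {d : ℕ} (α : MultiIndex d) : ℕ ×ₗ Lex (Fin d → ℕ) := toLex (α.maxNorm, toLex α)

theorem key_injective {d : ℕ} : Function.Injective (key (d := d)) := by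
  intro α β h
  have h2 := congrArg (fun z => (ofLex z).2) h
  exact h2

/-- The graded lexicographic order: `α < β` iff `maxNorm α < maxNorm β`, or
`maxNorm α = maxNorm β` and `α` is smaller than `β` in the usual lexicographic order. -/
noncomputable instance instLinearOrder {d : ℕ} : LinearOrder (MultiIndex d) :=
  LinearOrder.lift' key key_injective

theorem lt_iff {d : ℕ} (α β : MultiIndex d) :
    α < β ↔ α.maxNorm < β.maxNorm ∨
      α.maxNorm = β.maxNorm ∧ ∃ j, (∀ i < j, α i = β i) ∧ α j < β j := by
  change key α < key β ↔ _
  rw [Prod.Lex.lt_iff]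
  exact Iff.rfl

theorem maxNorm_mono {d : ℕ} {α β : MultiIndex d} (h : α ≤ β) : α.maxNorm ≤ β.maxNorm := by
  rcases h.lt_or_eq with h | h
  · rcases (lt_iff α β).1 h with h | h
    · exact h.le
    · exact h.1.le
  · rw [h]

theorem finite_Icc {d : ℕ} (α β : MultiIndex d) : (Set.Icc α β).Finite := by
  refine Set.Finite.subset (Set.finite_Iic (α := Fin d → ℕ) fun _ => β.maxNorm) ?_
  intro γ hγ i
  exact (Finset.le_sup (f := γ) (Finset.mem_univ i)).trans (maxNorm_mono hγ.2)

noncomputable instance instLocallyFiniteOrder {d : ℕ} : LocallyFiniteOrder (MultiIndex d) :=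
  LocallyFiniteOrder.ofFiniteIcc finite_Icc

noncomputable instance instOrderBot {d : ℕ} : OrderBot (MultiIndex d) where
  bot := fun _ => 0
  bot_le α := by
    refine le_of_not_gt fun h => ?_
    rcases (lt_iff _ _).1 h with h | ⟨-, j, -, h⟩
    · have h0 : maxNorm (fun _ => 0 : MultiIndex d) = 0 :=
        Nat.le_zero.1 (Finset.sup_le fun _ _ => le_rfl)
      omega
    · exact Nat.not_lt_zero _ h

instance instNoMaxOrder {d : ℕ} [NeZero d] : NoMaxOrder (MultiIndex d) where
  exists_gt α := by
    refine ⟨fun _ => α.maxNorm + 1, (lt_iff _ _).2 (Or.inl ?_)⟩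
    have h : α.maxNorm + 1 ≤ maxNorm (fun _ => α.maxNorm + 1 : MultiIndex d) :=
      Finset.le_sup (f := fun _ : Fin d => α.maxNorm + 1) (Finset.mem_univ (0 : Fin d))
    omega

/-- The unique increasing bijection from `ℕ` onto the multi-indices `ℕ^d` (with `d ≥ 1`), ordered
by the graded lexicographic order. -/
noncomputable def enum (d : ℕ) [NeZero d] : ℕ ≃o MultiIndex d :=
  letI : SuccOrder (MultiIndex d) := LinearLocallyFiniteOrder.succOrder (MultiIndex d)
  letI : PredOrder (MultiIndex d) := LinearLocallyFiniteOrder.predOrder (MultiIndex d)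
  (orderIsoNatOfLinearSuccPredArch (ι := MultiIndex d)).symm

end MultiIndex

/-- Gram-Schmidt orthogonalization in `L²(μ)`, without normalization, of a sequence of real
functions `f 0, f 1, …`; it is carried out on the functions themselves, not on their classes modulo
`μ`-null sets. -/
noncomputable def orthogonalized {X : Type*} [MeasurableSpace X] (μ : Measure X)
    (f : ℕ → X → ℝ) (n : ℕ) : X → ℝ := fun x =>
  f n x - ∑ i : Fin n,
    (∫ y, f n y * orthogonalized μ f i y ∂μ) / (∫ y, (orthogonalized μ f i y) ^ 2 ∂μ) *
      orthogonalized μ f i x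
termination_by n
decreasing_by all_goals exact i.2

/-- Gram-Schmidt orthonormalization in `L²(μ)` of a sequence of real functions. -/
noncomputable def orthonormalized {X : Type*} [MeasurableSpace X] (μ : Measure X)
    (f : ℕ → X → ℝ) (n : ℕ) : X → ℝ := fun x =>
  orthogonalized μ f n x / Real.sqrt (∫ y, (orthogonalized μ f n y) ^ 2 ∂μ)

/-- The orthonormal polynomials `φ_0, φ_1, …` of a measure on the real line. -/
noncomputable def orthoPoly (μ : Measure ℝ) : ℕ → ℝ → ℝ :=
  orthonormalized μ fun n x => x ^ n

/-- The coefficient `a_k` in `x φ_k = a_k φ_{k+1} + b_k φ_k + a_{k-1} φ_{k-1}`, that is, the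
coordinate of `x φ_k` along `φ_{k+1}`. -/
noncomputable def recurrenceA (μ : Measure ℝ) (k : ℕ) : ℝ :=
  ∫ x, x * orthoPoly μ k x * orthoPoly μ (k + 1) x ∂μ

/-- The coefficient `b_k` in `x φ_k = a_k φ_{k+1} + b_k φ_k + a_{k-1} φ_{k-1}`, that is, the
coordinate of `x φ_k` along `φ_k`. -/
noncomputable def recurrenceB (μ : Measure ℝ) (k : ℕ) : ℝ :=
  ∫ x, x * orthoPoly μ k x * orthoPoly μ k x ∂μ

/-- The Nevai class on `I = [-1, 1]`: measures carried by `I` that have well-defined orthonormal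
polynomials, with recurrence coefficients `a_k → 1/2` and `b_k → 0`. -/
structure IsNevaiClass (μ : Measure ℝ) : Prop where
  supported : μ (Set.Icc (-1) 1)ᶜ = 0
  nondegenerate : ∀ p : Polynomial ℝ, p ≠ 0 → 0 < ∫ x, (p.eval x) ^ 2 ∂μ
  tendsto_a : Tendsto (recurrenceA μ) atTop (𝓝 (1 / 2))
  tendsto_b : Tendsto (recurrenceB μ) atTop (𝓝 0)

/-- The equilibrium (arcsine) measure of `[-1, 1]`, with density `1 / (π √(1 - x²))`. -/
noncomputable def equilibriumMeasure : Measure ℝ :=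
  volume.withDensity fun x =>
    ENNReal.ofReal ((Set.Icc (-1 : ℝ) 1).indicator (fun t => 1 / (Real.pi * √(1 - t ^ 2))) x)

/-- The multivariate orthonormal polynomials of a measure `μ` on `ℝ^d`: Gram-Schmidt applied to the
monomials, taken in the graded lexicographic order of their exponents. -/
noncomputable def multiOrthoPoly {d : ℕ} [NeZero d] (μ : Measure (Fin d → ℝ)) :
    ℕ → (Fin d → ℝ) → ℝ :=
  orthonormalized μ fun n x => ∏ j : Fin d, x j ^ (MultiIndex.enum d n j)

/-- The Christoffel-Darboux kernel `K_N(x, y) = ∑_{k < N} φ_k(x) φ_k(y)`. -/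
noncomputable def cdKernel {d : ℕ} [NeZero d] (μ : Measure (Fin d → ℝ)) (N : ℕ)
    (x y : Fin d → ℝ) : ℝ :=
  ∑ k ∈ Finset.range N, multiOrthoPoly μ k x * multiOrthoPoly μ k y

/-- The multivariate orthogonal polynomial ensemble: the joint law of `(x_1, …, x_N)`, with density
`(1 / N!) det [K_N(x_i, x_l)]` with respect to `μ^{⊗ N}`. -/
noncomputable def opEnsemble {d : ℕ} [NeZero d] (μ : Measure (Fin d → ℝ)) (N : ℕ) :
    Measure (Fin N → Fin d → ℝ) :=
  (Measure.pi fun _ : Fin N => μ).withDensity fun x =>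
    ENNReal.ofReal
      ((N.factorial : ℝ)⁻¹ * (Matrix.of fun i l : Fin N => cdKernel μ N (x i) (x l)).det)

/-- The linear statistic `∑_i P(x_i)` of a polynomial `P`. -/
noncomputable def linearStatistic {d : ℕ} (P : MvPolynomial (Fin d) ℝ) (N : ℕ)
    (x : Fin N → Fin d → ℝ) : ℝ :=
  ∑ i : Fin N, MvPolynomial.eval (x i) P

/-!
# Covariances of linear statistics of multivariate orthogonal polynomial ensembles

For a determinantal ensemble built from orthonormal functions `φ_k`, expanding the determinants
shows that the covariance of two linear statistics is
`∑_{k < N} (⟨f g φ_k, φ_k⟩ - ∑_{l < N} ⟨f φ_k, φ_l⟩ ⟨g φ_k, φ_l⟩)` (`covariance_ensemble`). When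
`f φ_k` and `g φ_k` are combinations of the `φ_l`, Parseval's identity turns this into the boundary
sum `∑_{k < N ≤ l} ⟨f φ_k, φ_l⟩ ⟨g φ_k, φ_l⟩`.

For a product measure, the multivariate orthonormal polynomials are the tensor products of the
univariate ones (`multiOrthoPoly_pi`): the graded lexicographic order refines the coordinatewise
order, and the Gram-Schmidt process is determined by triangularity and orthonormality
(`orthonormalized_eq`). For monomials `f = x^m` and `g = x^m'` the terms of the boundary sum are
then products over the coordinates of entries of powers of Jacobi matrices. These entries vanish
outside a band, are at most `1` in absolute value, and converge along every diagonal to a limit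
that only depends on the limits of the recurrence coefficients (`exists_tendsto_jacobiPow`).
The equilibrium measure has the normalized Chebyshev polynomials as orthonormal polynomials, hence
the same limits as any Nevai-class measure (`isNevaiSystem_chebyshevSystem`).

The difference between the two covariances is therefore at most a constant times a sum of
`ε_j(α_j)`, with `ε_j → 0`, over those `α` among the first `N` multi-indices that are at bounded
distance from the complement (`abs_covariance_monomial_sub_le`). The first `N` multi-indices lie
between two cubes of sides `n` and `n + 1`, with `n^d ≤ N`, so these `α` lie within bounded distance
of the faces of a cube of side `n`. There are `O(n^(d-1))` of them, and on each face a coordinate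
`α_j` either is close to `n` or runs freely through `[0, n]`. In both cases `ε_j(α_j)` is small on
average, in the second one by Cesàro's theorem, so that the sum is `o(N^(1 - 1/d))`
(`tendsto_sum_shell_div`). General polynomials follow by bilinearity.
-/

/-! ### Powers of Jacobi matrices -/

theorem integrable_of_continuous_of_compl_null {X : Type*} [TopologicalSpace X] [T2Space X]
    [MeasurableSpace X] [OpensMeasurableSpace X] {ν : Measure X} [IsFiniteMeasure ν] {K : Set X}
    (hK : IsCompact K) (hν : ν Kᶜ = 0) {f : X → ℝ} (hf : Continuous f) : Integrable f ν := by
  have h := hf.continuousOn.integrableOn_compact (μ := ν) hK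
  have hr : ν.restrict K = ν := Measure.restrict_eq_self_of_ae_mem hν
  rwa [IntegrableOn, hr] at h

/-- A sequence of polynomials `p 0, p 1, …`, with `p n` of degree `n` and positive leading
coefficient, that is orthonormal for a measure `ν` carried by `[-1, 1]`. -/
structure IsOrthonormalSystem (ν : Measure ℝ) (p : ℕ → Polynomial ℝ) : Prop where
  supported : ν (Set.Icc (-1) 1)ᶜ = 0
  natDegree_eq : ∀ n, (p n).natDegree = n
  leadingCoeff_pos : ∀ n, 0 < (p n).leadingCoeff
  integral_mul : ∀ i j, ∫ x, (p i).eval x * (p j).eval x ∂ν = if i = j then 1 else 0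

/-- The entry `⟨x^m p_n, p_l⟩` of the `m`-th power of the Jacobi matrix. -/
noncomputable def jacobiPow (ν : Measure ℝ) (p : ℕ → Polynomial ℝ) (m n l : ℕ) : ℝ :=
  ∫ x, x ^ m * (p n).eval x * (p l).eval x ∂ν

theorem jacobiPow_comm (ν : Measure ℝ) (p : ℕ → Polynomial ℝ) (m n l : ℕ) :
    jacobiPow ν p m n l = jacobiPow ν p m l n := by
  unfold jacobiPow
  congr 1; ext x; ring

namespace IsOrthonormalSystem

variable {ν : Measure ℝ} {p : ℕ → Polynomial ℝ}

theorem jacobiPow_zero (hp : IsOrthonormalSystem ν p) (n l : ℕ) :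
    jacobiPow ν p 0 n l = if n = l then 1 else 0 := by
  simpa [jacobiPow] using hp.integral_mul n l

/-- The first `L` polynomials of the system span the polynomials of degree less than `L`. -/
theorem exists_eq_sum (hp : IsOrthonormalSystem ν p) (L : ℕ) :
    ∀ q : Polynomial ℝ, q.degree < L →
      ∃ c : ℕ → ℝ, q = ∑ i ∈ Finset.range L, Polynomial.C (c i) * p i := by
  induction L with
  | zero =>
    intro q hq
    refine ⟨0, ?_⟩
    simpa using hq
  | succ L ih =>
    intro q hq
    -- Subtracting a multiple of `p L` cancels the coefficient of `x^L`.
    set r := q - Polynomial.C (q.coeff L / (p L).leadingCoeff) * p L with hr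
    have hpL : (p L).coeff L = (p L).leadingCoeff := by
      rw [Polynomial.leadingCoeff, hp.natDegree_eq]
    have hrd : r.degree < L := by
      rw [Polynomial.degree_lt_iff_coeff_zero] at hq ⊢
      intro k hk
      rcases hk.eq_or_lt with rfl | hk
      · have := (hp.leadingCoeff_pos L).ne'
        simp only [hr, Polynomial.coeff_sub, Polynomial.coeff_C_mul, hpL]
        field_simp
        ring
      · have h1 : (p L).coeff k = 0 :=
          Polynomial.coeff_eq_zero_of_natDegree_lt (by rwa [hp.natDegree_eq])
        simp [hr, hq k hk, h1]
    obtain ⟨c, hc⟩ := ih r hrd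
    refine ⟨Function.update c L (q.coeff L / (p L).leadingCoeff), ?_⟩
    rw [Finset.sum_range_succ, Function.update_self]
    have : ∑ i ∈ Finset.range L, Polynomial.C (Function.update c L
        (q.coeff L / (p L).leadingCoeff) i) * p i = r := by
      rw [hc]
      refine Finset.sum_congr rfl fun i hi => ?_
      rw [Function.update_of_ne (Finset.mem_range.1 hi).ne]
    rw [this, hr]; ring

variable [IsFiniteMeasure ν]

theorem integrable (hp : IsOrthonormalSystem ν p) {f : ℝ → ℝ} (hf : Continuous f) :
    Integrable f ν :=
  integrable_of_continuous_of_compl_null isCompact_Icc hp.supported hf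

/-- Expansion of a polynomial in the orthonormal system; the coefficients are the scalar
products. -/
theorem eval_eq_sum (hp : IsOrthonormalSystem ν p) {L : ℕ} {q : Polynomial ℝ}
    (hq : q.degree < L) (x : ℝ) :
    q.eval x = ∑ i ∈ Finset.range L, (∫ y, q.eval y * (p i).eval y ∂ν) * (p i).eval x := by
  obtain ⟨c, hc⟩ := hp.exists_eq_sum L q hq
  have hev : ∀ y, q.eval y = ∑ i ∈ Finset.range L, c i * (p i).eval y := by
    intro y
    conv_lhs => rw [hc]
    simp [Polynomial.eval_finsetSum]
  rw [hev x]
  refine Finset.sum_congr rfl fun i hi => ?_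
  congr 1
  simp_rw [hev, Finset.sum_mul]
  rw [integral_finsetSum _ fun j _ => hp.integrable (by fun_prop)]
  simp_rw [mul_assoc, integral_const_mul, hp.integral_mul]
  simp [Finset.mem_range.1 hi]

/-- Only the `p l` with `l ≤ n + m` enter the expansion of `x^m p_n`. -/
theorem pow_mul_eval_eq_sum (hp : IsOrthonormalSystem ν p) {m n L : ℕ} (hL : n + m < L) (x : ℝ) :
    x ^ m * (p n).eval x = ∑ l ∈ Finset.range L, jacobiPow ν p m n l * (p l).eval x := by
  have hd : (Polynomial.X ^ m * p n : Polynomial ℝ).degree < L := by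
    refine (Polynomial.degree_le_natDegree).trans_lt ?_
    have h1 := Polynomial.natDegree_mul_le (p := (Polynomial.X ^ m : Polynomial ℝ)) (q := p n)
    rw [Polynomial.natDegree_X_pow, hp.natDegree_eq] at h1
    exact_mod_cast (by omega : (Polynomial.X ^ m * p n : Polynomial ℝ).natDegree < L)
  simpa [jacobiPow] using hp.eval_eq_sum hd x

/-- The Jacobi powers multiply like matrices. -/
theorem jacobiPow_add (hp : IsOrthonormalSystem ν p) (m m' n k : ℕ) {L : ℕ} (hL : n + m < L) :
    jacobiPow ν p (m + m') n k =
      ∑ l ∈ Finset.range L, jacobiPow ν p m n l * jacobiPow ν p m' l k := by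
  have h : ∀ x : ℝ, x ^ (m + m') * (p n).eval x * (p k).eval x =
      ∑ l ∈ Finset.range L, jacobiPow ν p m n l * (x ^ m' * (p l).eval x * (p k).eval x) := by
    intro x
    calc _ = (x ^ m * (p n).eval x) * (x ^ m' * (p k).eval x) := by ring
      _ = _ := by
        rw [hp.pow_mul_eval_eq_sum hL, Finset.sum_mul]
        exact Finset.sum_congr rfl fun l _ => by ring
  conv_lhs => rw [jacobiPow]
  simp_rw [h]
  rw [integral_finsetSum _ fun j _ => hp.integrable (by fun_prop)]
  simp_rw [integral_const_mul]
  rfl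

theorem jacobiPow_eq_zero (hp : IsOrthonormalSystem ν p) {m n l : ℕ} (h : n + m < l) :
    jacobiPow ν p m n l = 0 := by
  unfold jacobiPow
  simp_rw [hp.pow_mul_eval_eq_sum (Nat.lt_succ_self (n + m)), Finset.sum_mul]
  rw [integral_finsetSum _ fun j _ => hp.integrable (by fun_prop)]
  refine Finset.sum_eq_zero fun i hi => ?_
  simp_rw [mul_assoc, integral_const_mul, hp.integral_mul]
  rw [if_neg (by have := Finset.mem_range.1 hi; omega), mul_zero]

theorem jacobiPow_eq_zero' (hp : IsOrthonormalSystem ν p) {m n l : ℕ} (h : l + m < n) :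
    jacobiPow ν p m n l = 0 := by
  rw [jacobiPow_comm, hp.jacobiPow_eq_zero h]

/-- The entries of the Jacobi powers are bounded because `|x| ≤ 1` on the support. -/
theorem abs_jacobiPow_le_one (hp : IsOrthonormalSystem ν p) (m n l : ℕ) :
    |jacobiPow ν p m n l| ≤ 1 := by
  have hae : ∀ᵐ x ∂ν, x ∈ Set.Icc (-1 : ℝ) 1 := hp.supported
  have hle : ∫ x, ((p n).eval x * (p n).eval x + (p l).eval x * (p l).eval x) / 2 ∂ν = 1 := by
    rw [integral_div, integral_add (hp.integrable (by fun_prop)) (hp.integrable (by fun_prop)),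
      hp.integral_mul, hp.integral_mul]
    norm_num
  rw [← hle, ← Real.norm_eq_abs]
  refine norm_integral_le_of_norm_le (hp.integrable (by fun_prop)) ?_
  filter_upwards [hae] with x hx
  rw [Real.norm_eq_abs, mul_assoc, abs_mul, abs_pow]
  have h1 : |x| ^ m ≤ 1 := pow_le_one₀ (abs_nonneg x) (abs_le.2 ⟨hx.1, hx.2⟩)
  -- The inequality `|uv| ≤ (u² + v²) / 2`, whose right-hand side integrates to `1`.
  have h2 : |(p n).eval x * (p l).eval x| ≤
      ((p n).eval x * (p n).eval x + (p l).eval x * (p l).eval x) / 2 := by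
    rw [abs_le]
    constructor
    · nlinarith [sq_nonneg ((p n).eval x + (p l).eval x)]
    · nlinarith [sq_nonneg ((p n).eval x - (p l).eval x)]
  calc _ ≤ 1 * |(p n).eval x * (p l).eval x| := by gcongr
    _ ≤ _ := by rwa [one_mul]

/-- The three-term recurrence, read on the entries of the Jacobi powers. -/
theorem jacobiPow_succ (hp : IsOrthonormalSystem ν p) (m n k : ℕ) :
    jacobiPow ν p (1 + m) (n + 1) k =
      jacobiPow ν p 1 n (n + 1) * jacobiPow ν p m n k +
      jacobiPow ν p 1 (n + 1) (n + 1) * jacobiPow ν p m (n + 1) k +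
      jacobiPow ν p 1 (n + 1) (n + 2) * jacobiPow ν p m (n + 2) k := by
  rw [hp.jacobiPow_add 1 m (n + 1) k (L := n + 3) (by omega), Finset.sum_range_succ,
    Finset.sum_range_succ, Finset.sum_range_succ, Finset.sum_eq_zero, zero_add,
    jacobiPow_comm ν p 1 (n + 1) n]
  intro l hl
  rw [hp.jacobiPow_eq_zero' (by have := Finset.mem_range.1 hl; omega), zero_mul]

end IsOrthonormalSystem

/-- An orthonormal system whose recurrence coefficients satisfy `a_k → 1/2` and `b_k → 0`. -/
structure IsNevaiSystem (ν : Measure ℝ) (p : ℕ → Polynomial ℝ) : Prop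
    extends IsOrthonormalSystem ν p where
  tendsto_a : Tendsto (fun k => jacobiPow ν p 1 k (k + 1)) atTop (𝓝 (1 / 2))
  tendsto_b : Tendsto (fun k => jacobiPow ν p 1 k k) atTop (𝓝 0)

/-- Along each diagonal, the entries of the `m`-th Jacobi power have a limit, the same for all
Nevai systems: the entry of the `m`-th power of the free Jacobi matrix. -/
theorem exists_tendsto_jacobiPow (m i j : ℕ) : ∃ c : ℝ, ∀ (ν : Measure ℝ) (_ : IsFiniteMeasure ν)
    (p : ℕ → Polynomial ℝ), IsNevaiSystem ν p →
      Tendsto (fun n => jacobiPow ν p m (n + i) (n + j)) atTop (𝓝 c) := by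
  induction m generalizing i j with
  | zero =>
    refine ⟨if i = j then 1 else 0, fun ν _ p hp => ?_⟩
    simp [hp.jacobiPow_zero]
  | succ m ih =>
    obtain ⟨c₀, h₀⟩ := ih i (j + 1)
    obtain ⟨c₁, h₁⟩ := ih (i + 1) (j + 1)
    obtain ⟨c₂, h₂⟩ := ih (i + 2) (j + 1)
    refine ⟨1 / 2 * c₀ + 0 * c₁ + 1 / 2 * c₂, fun ν _ p hp => ?_⟩
    rw [← tendsto_add_atTop_iff_nat 1]
    have hsh : ∀ n, jacobiPow ν p (m + 1) (n + 1 + i) (n + 1 + j) = _ := fun n => by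
      rw [show n + 1 + i = n + i + 1 by ring, show n + 1 + j = n + (j + 1) by ring, add_comm m 1,
        hp.jacobiPow_succ m (n + i) (n + (j + 1))]
    simp_rw [hsh]
    refine ((Tendsto.mul ?_ (h₀ ν ‹_› p hp)).add (Tendsto.mul ?_ (h₁ ν ‹_› p hp))).add
      (Tendsto.mul ?_ (h₂ ν ‹_› p hp))
    · exact hp.tendsto_a.comp (tendsto_add_atTop_nat i)
    · exact hp.tendsto_b.comp (tendsto_add_atTop_nat (i + 1))
    · exact hp.tendsto_a.comp (tendsto_add_atTop_nat (i + 1))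

/-- The entry products `⟨x^m p_n, p_l⟩ ⟨x^m' p_n, p_l⟩` of the covariance formula. -/
noncomputable def jacobiProd (ν : Measure ℝ) (p : ℕ → Polynomial ℝ) (m m' n l : ℕ) : ℝ :=
  jacobiPow ν p m n l * jacobiPow ν p m' n l

namespace IsOrthonormalSystem

variable {ν : Measure ℝ} [IsFiniteMeasure ν] {p : ℕ → Polynomial ℝ}

theorem abs_jacobiProd_le_one (hp : IsOrthonormalSystem ν p) (m m' n l : ℕ) :
    |jacobiProd ν p m m' n l| ≤ 1 := by
  rw [jacobiProd, abs_mul]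
  exact mul_le_one₀ (hp.abs_jacobiPow_le_one m n l) (abs_nonneg _) (hp.abs_jacobiPow_le_one m' n l)

theorem jacobiProd_eq_zero (hp : IsOrthonormalSystem ν p) {m m' n l M : ℕ} (hM : m ≤ M)
    (hl : l ∉ Finset.Icc (n - M) (n + M)) : jacobiProd ν p m m' n l = 0 := by
  rw [Finset.mem_Icc, not_and_or, not_le, not_le] at hl
  rw [jacobiProd]
  rcases hl with h | h
  · rw [hp.jacobiPow_eq_zero' (by omega), zero_mul]
  · rw [hp.jacobiPow_eq_zero (by omega), zero_mul]

/-- Parseval's identity for `x^m p_n` and `x^m' p_n`; only a band of entries contributes. -/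
theorem jacobiPow_diag_eq_sum (hp : IsOrthonormalSystem ν p) {m M : ℕ} (hM : m ≤ M) (m' n : ℕ) :
    jacobiPow ν p (m + m') n n = ∑ l ∈ Finset.Icc (n - M) (n + M), jacobiProd ν p m m' n l := by
  rw [hp.jacobiPow_add m m' n n (L := n + M + 1) (by omega)]
  symm
  calc _ = ∑ l ∈ Finset.range (n + M + 1), jacobiProd ν p m m' n l := by
        refine Finset.sum_subset (fun l hl => ?_) fun l _ hl => hp.jacobiProd_eq_zero hM hl
        rw [Finset.mem_Icc] at hl
        rw [Finset.mem_range]; omega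
    _ = _ := Finset.sum_congr rfl fun l _ => by rw [jacobiProd, jacobiPow_comm ν p m' n l]

end IsOrthonormalSystem

/-- The total difference along the `n`-th row of the band between two measures. -/
noncomputable def jacobiRowDiff (ν ν' : Measure ℝ) (p p' : ℕ → Polynomial ℝ) (m m' M n : ℕ) : ℝ :=
  ∑ l ∈ Finset.Icc (n - M) (n + M), |jacobiProd ν p m m' n l - jacobiProd ν' p' m m' n l|

/-- A row of the band is a finite number of diagonal entries, and along each diagonal the two
measures have the same limit. -/
theorem tendsto_jacobiRowDiff {ν ν' : Measure ℝ} [IsFiniteMeasure ν] [IsFiniteMeasure ν']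
    {p p' : ℕ → Polynomial ℝ} (hp : IsNevaiSystem ν p) (hp' : IsNevaiSystem ν' p') (m m' M : ℕ) :
    Tendsto (jacobiRowDiff ν ν' p p' m m' M) atTop (𝓝 0) := by
  -- Shifting the row index by `M` makes the truncated subtraction in `n - M` harmless.
  rw [← tendsto_add_atTop_iff_nat M]
  have h : ∀ n, jacobiRowDiff ν ν' p p' m m' M (n + M) = ∑ k ∈ Finset.range (2 * M + 1),
      |jacobiProd ν p m m' (n + M) (n + k) - jacobiProd ν' p' m m' (n + M) (n + k)| := by
    intro n
    rw [jacobiRowDiff, Nat.add_sub_cancel, ← Finset.Ico_succ_right_eq_Icc,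
      Finset.sum_Ico_eq_sum_range]
    congr 2
    simp only [Order.succ_eq_add_one]
    omega
  simp_rw [h]
  rw [← Finset.sum_const_zero (s := Finset.range (2 * M + 1)) (M := ℝ)]
  refine tendsto_finsetSum _ fun k _ => ?_
  obtain ⟨c, hc⟩ := exists_tendsto_jacobiPow m M k
  obtain ⟨c', hc'⟩ := exists_tendsto_jacobiPow m' M k
  have := (((hc ν ‹_› p hp).mul (hc' ν ‹_› p hp)).sub
    ((hc ν' ‹_› p' hp').mul (hc' ν' ‹_› p' hp'))).abs
  simpa [jacobiProd] using this

/-! ### The Gram-Schmidt process -/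

/-- Uniqueness of the Gram-Schmidt process: if the `f n` are triangular combinations of an
orthonormal sequence `e`, with positive diagonal coefficients, then orthonormalizing `f` gives `e`,
as functions. -/
theorem orthonormalized_eq {X : Type*} [MeasurableSpace X] {ν : Measure X} {f e : ℕ → X → ℝ}
    {c : ℕ → ℕ → ℝ} (hint : ∀ i j, Integrable (fun x => e i x * e j x) ν)
    (he : ∀ i j, ∫ x, e i x * e j x ∂ν = if i = j then 1 else 0) (hc : ∀ n, 0 < c n n)
    (hf : ∀ n x, f n x = ∑ i ∈ Finset.range (n + 1), c n i * e i x) (n : ℕ) :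
    orthonormalized ν f n = e n := by
  have hg : ∀ n x, orthogonalized ν f n x = c n n * e n x := by
    intro n
    induction n using Nat.strong_induction_on with
    | _ n ih =>
      intro x
      rw [orthogonalized]
      have hco : ∀ i : Fin n, (∫ y, f n y * orthogonalized ν f i y ∂ν) /
          (∫ y, (orthogonalized ν f i y) ^ 2 ∂ν) * orthogonalized ν f i x = c n i * e i x := by
        intro i
        have h1 : ∫ y, f n y * orthogonalized ν f i y ∂ν = c i i * c n i := by
          simp_rw [ih i i.2, hf n, Finset.sum_mul]
          have h2 : ∀ (y : X) (k : ℕ), c n k * e k y * (c i i * e i y) =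
              c i i * c n k * (e k y * e i y) := fun y k => by ring
          simp_rw [h2]
          rw [integral_finsetSum _ fun k _ => (hint k i).const_mul _]
          simp_rw [integral_const_mul, he]
          simp [show (i : ℕ) < n + 1 by omega]
        have h2 : ∫ y, (orthogonalized ν f i y) ^ 2 ∂ν = c i i ^ 2 := by
          simp_rw [ih i i.2, mul_pow, integral_const_mul, pow_two (e i _), he]
          simp
        have := (hc i).ne'
        rw [h1, h2, ih i i.2]
        field_simp
      simp_rw [hco, hf n x, Finset.sum_range_succ]
      rw [Fin.sum_univ_eq_sum_range (fun i => c n i * e i x)]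
      ring
  ext x
  have h2 : ∫ y, (orthogonalized ν f n y) ^ 2 ∂ν = c n n ^ 2 := by
    simp_rw [hg n, mul_pow, integral_const_mul, pow_two (e n _), he]
    simp
  have := (hc n).ne'
  rw [orthonormalized, h2, hg, Real.sqrt_sq (hc n).le]
  field_simp

/-- The Gram-Schmidt process without normalization yields orthogonal functions. -/
theorem integral_orthogonalized_mul {X : Type*} [MeasurableSpace X] {ν : Measure X}
    {f : ℕ → X → ℝ}
    (hfi : ∀ i j, Integrable (fun x => f i x * orthogonalized ν f j x) ν)
    (hint : ∀ i j, Integrable (fun x => orthogonalized ν f i x * orthogonalized ν f j x) ν)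
    (hpos : ∀ n, 0 < ∫ x, (orthogonalized ν f n x) ^ 2 ∂ν) {m n : ℕ} (hmn : m < n) :
    ∫ x, orthogonalized ν f n x * orthogonalized ν f m x ∂ν = 0 := by
  induction n using Nat.strong_induction_on generalizing m with
  | _ n ih =>
    have h : ∀ x, orthogonalized ν f n x * orthogonalized ν f m x =
        f n x * orthogonalized ν f m x - ∑ i : Fin n,
          (∫ y, f n y * orthogonalized ν f i y ∂ν) / (∫ y, (orthogonalized ν f i y) ^ 2 ∂ν) *
            (orthogonalized ν f i x * orthogonalized ν f m x) := by
      intro x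
      conv_lhs => rw [orthogonalized]
      simp_rw [sub_mul, Finset.sum_mul, mul_assoc]
    have hi : ∀ i : Fin n, Integrable (fun x =>
        (∫ y, f n y * orthogonalized ν f i y ∂ν) / (∫ y, (orthogonalized ν f i y) ^ 2 ∂ν) *
          (orthogonalized ν f i x * orthogonalized ν f m x)) ν :=
      fun i => (hint i m).const_mul _
    simp_rw [h]
    rw [integral_sub (hfi n m) (integrable_finsetSum _ fun i _ => hi i),
      integral_finsetSum _ fun i _ => hi i]
    simp_rw [integral_const_mul]
    rw [Finset.sum_eq_single (⟨m, hmn⟩ : Fin n)]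
    · have := (hpos m).ne'
      simp only [← pow_two]
      field_simp
      ring
    · intro i _ hi
      have hi' : (i : ℕ) ≠ m := fun h => hi (Fin.ext h)
      rcases lt_or_gt_of_ne hi' with h | h
      · simp_rw [mul_comm (orthogonalized ν f i _)]
        rw [ih m hmn h, mul_zero]
      · rw [ih i i.2 h, mul_zero]
    · simp

/-- Orthogonalizing the monomials gives monic polynomials of the right degrees. -/
theorem exists_monic_orthogonalized_pow (ν : Measure ℝ) (n : ℕ) :
    ∃ q : Polynomial ℝ, q.Monic ∧ q.natDegree = n ∧
      ∀ x, orthogonalized ν (fun n x => x ^ n) n x = q.eval x := by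
  induction n using Nat.strong_induction_on with
  | _ n ih =>
    choose q hq using fun i : Fin n => ih i i.2
    set c : Fin n → ℝ := fun i =>
      (∫ y, y ^ n * orthogonalized ν (fun n x => x ^ n) i y ∂ν) /
        (∫ y, (orthogonalized ν (fun n x => x ^ n) i y) ^ 2 ∂ν) with hc
    have hdeg : (∑ i, Polynomial.C (c i) * q i).degree < n := by
      refine (Polynomial.degree_sum_le _ _).trans_lt ?_
      rw [Finset.sup_lt_iff (by exact_mod_cast WithBot.bot_lt_coe n)]
      intro i _
      refine Polynomial.degree_le_natDegree.trans_lt ?_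
      have h1 := Polynomial.natDegree_C_mul_le (c i) (q i)
      rw [(hq i).2.1] at h1
      exact_mod_cast h1.trans_lt i.2
    refine ⟨Polynomial.X ^ n - ∑ i, Polynomial.C (c i) * q i, Polynomial.monic_X_pow_sub hdeg, ?_,
      fun x => ?_⟩
    · refine Polynomial.natDegree_eq_of_degree_eq_some ?_
      rw [Polynomial.degree_sub_eq_left_of_degree_lt] <;> rw [Polynomial.degree_X_pow]
      exact hdeg
    · rw [orthogonalized]
      simp [Polynomial.eval_finsetSum, (hq _).2.2, hc]

namespace IsOrthonormalSystem

variable {ν : Measure ℝ} {p : ℕ → Polynomial ℝ}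

/-- The monomials are triangular combinations of the system, with positive diagonal coefficients. -/
theorem exists_triangular (hp : IsOrthonormalSystem ν p) : ∃ c : ℕ → ℕ → ℝ,
    (∀ n, 0 < c n n) ∧ (∀ n i, n < i → c n i = 0) ∧
      ∀ n x, x ^ n = ∑ i ∈ Finset.range (n + 1), c n i * (p i).eval x := by
  have h : ∀ n : ℕ, ∃ c : ℕ → ℝ, (Polynomial.X ^ n : Polynomial ℝ) =
      ∑ i ∈ Finset.range (n + 1), Polynomial.C (c i) * p i := fun n =>
    hp.exists_eq_sum (n + 1) _ (by
      rw [Polynomial.degree_X_pow]; exact_mod_cast Nat.lt_succ_self n)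
  choose c hc using h
  refine ⟨fun n i => if i ≤ n then c n i else 0, fun n => ?_, fun n i hi => by simp [hi], ?_⟩
  · have h1 := congrArg (fun q => Polynomial.coeff q n) (hc n)
    simp only [Finset.sum_range_succ, Polynomial.coeff_add, Polynomial.finsetSum_coeff,
      Polynomial.coeff_C_mul, Polynomial.coeff_X_pow_self] at h1
    have h2 : (p n).coeff n = (p n).leadingCoeff := by
      rw [Polynomial.leadingCoeff, hp.natDegree_eq]
    rw [Finset.sum_eq_zero, zero_add, h2] at h1
    · simp only [le_refl, if_true]
      exact pos_of_mul_pos_left (h1 ▸ one_pos) (hp.leadingCoeff_pos n).le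
    · intro i hi
      rw [Polynomial.coeff_eq_zero_of_natDegree_lt, mul_zero]
      rw [hp.natDegree_eq]; exact Finset.mem_range.1 hi
  · intro n x
    have h1 := congrArg (fun q => Polynomial.eval x q) (hc n)
    simp only [Polynomial.eval_pow, Polynomial.eval_X, Polynomial.eval_finsetSum,
      Polynomial.eval_mul, Polynomial.eval_C] at h1
    rw [h1]
    refine Finset.sum_congr rfl fun i hi => ?_
    simp only [if_pos (Nat.le_of_lt_succ (Finset.mem_range.1 hi))]

end IsOrthonormalSystem

/-- The orthonormal polynomials of a Nevai-class measure form a Nevai system. -/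
theorem IsNevaiClass.exists_isNevaiSystem {ν : Measure ℝ} [IsFiniteMeasure ν]
    (hν : IsNevaiClass ν) : ∃ p, IsNevaiSystem ν p := by
  choose q hqm hqd hq using exists_monic_orthogonalized_pow ν
  have hint : ∀ {f : ℝ → ℝ}, Continuous f → Integrable f ν := fun hf =>
    integrable_of_continuous_of_compl_null isCompact_Icc hν.supported hf
  have hpos : ∀ n, 0 < ∫ x, (orthogonalized ν (fun n x => x ^ n) n x) ^ 2 ∂ν := by
    intro n
    simp_rw [hq]
    exact hν.nondegenerate _ (hqm n).ne_zero
  have horth : ∀ {m n : ℕ}, m < n → ∫ x, (q n).eval x * (q m).eval x ∂ν = 0 := by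
    intro m n hmn
    have h := integral_orthogonalized_mul (ν := ν) (f := fun n x => x ^ n)
      (fun i j => by simp_rw [hq]; exact hint (by fun_prop))
      (fun i j => by simp_rw [hq]; exact hint (by fun_prop)) hpos hmn
    simpa only [hq] using h
  set s : ℕ → ℝ := fun n => Real.sqrt (∫ x, (orthogonalized ν (fun n x => x ^ n) n x) ^ 2 ∂ν)
    with hs
  have hspos : ∀ n, 0 < s n := fun n => Real.sqrt_pos.2 (hpos n)
  have hφ : ∀ n x, orthoPoly ν n x = (Polynomial.C (s n)⁻¹ * q n).eval x := by
    intro n x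
    rw [orthoPoly, orthonormalized, hq]
    simp [hs, div_eq_inv_mul]
  refine ⟨fun n => Polynomial.C (s n)⁻¹ * q n, ⟨hν.supported, fun n => ?_, fun n => ?_, ?_⟩, ?_, ?_⟩
  · rw [Polynomial.natDegree_C_mul (inv_pos.2 (hspos n)).ne', hqd]
  · rw [Polynomial.leadingCoeff_mul, (hqm n).leadingCoeff, Polynomial.leadingCoeff_C, mul_one]
    exact inv_pos.2 (hspos n)
  · intro i j
    have h1 : ∀ x, (Polynomial.C (s i)⁻¹ * q i).eval x * (Polynomial.C (s j)⁻¹ * q j).eval x =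
        (s i)⁻¹ * (s j)⁻¹ * ((q i).eval x * (q j).eval x) := fun x => by
      simp only [Polynomial.eval_mul, Polynomial.eval_C]; ring
    simp_rw [h1, integral_const_mul]
    rcases lt_trichotomy i j with h | rfl | h
    · rw [if_neg h.ne]
      simp_rw [mul_comm (Polynomial.eval _ (q i))]
      rw [horth h, mul_zero]
    · have h2 : ∫ x, (q i).eval x * (q i).eval x ∂ν = s i * s i := by
        rw [hs, Real.mul_self_sqrt (hpos i).le]
        simp_rw [hq, pow_two]
      have := (hspos i).ne'
      rw [h2, if_pos rfl]
      field_simp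
    · rw [if_neg h.ne', horth h, mul_zero]
  · have h := hν.tendsto_a
    unfold recurrenceA at h
    simp only [hφ] at h
    simpa only [jacobiPow, pow_one] using h
  · have h := hν.tendsto_b
    unfold recurrenceB at h
    simp only [hφ] at h
    simpa only [jacobiPow, pow_one] using h

/-! ### The equilibrium measure and Chebyshev polynomials -/

open Polynomial.Chebyshev in
/-- The equilibrium measure is Mathlib's Chebyshev measure, normalized. -/
theorem equilibriumMeasure_eq_smul :
    equilibriumMeasure = ENNReal.ofReal Real.pi⁻¹ • measureT := by
  rw [measureT, restrict_withDensity measurableSet_Ioc, Measure.restrict_congr_set Ioc_ae_eq_Icc,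
    ← withDensity_indicator measurableSet_Icc,
    ← withDensity_smul _ (Measurable.indicator (by fun_prop) measurableSet_Icc),
    equilibriumMeasure]
  congr 1
  ext x
  simp only [Pi.smul_apply, smul_eq_mul, Set.indicator]
  split_ifs with hx
  · rw [← ENNReal.ofReal_coe_nnreal, ← ENNReal.ofReal_mul (inv_pos.2 Real.pi_pos).le]
    congr 1
    simp [mul_comm]
  · simp

open Polynomial.Chebyshev in
theorem integral_equilibriumMeasure (f : ℝ → ℝ) :
    ∫ x, f x ∂equilibriumMeasure = Real.pi⁻¹ * ∫ x, f x ∂measureT := by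
  rw [equilibriumMeasure_eq_smul, integral_smul_measure,
    ENNReal.toReal_ofReal (inv_pos.2 Real.pi_pos).le, smul_eq_mul]

open Polynomial.Chebyshev in
instance isProbabilityMeasure_equilibriumMeasure : IsProbabilityMeasure equilibriumMeasure := by
  have hfin : IsFiniteMeasure measureT := by
    have := integrable_measureT (f := fun _ => 1) continuousOn_const
    rw [integrable_const_iff] at this
    simpa using this
  have : IsFiniteMeasure equilibriumMeasure := by
    rw [equilibriumMeasure_eq_smul]
    exact Measure.smul_finite _ ENNReal.ofReal_ne_top
  have h := integral_equilibriumMeasure fun _ => 1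
  have h1 := integral_eval_T_real_measureT_zero
  simp only [T_zero, Polynomial.eval_one] at h1
  rw [h1, inv_mul_cancel₀ Real.pi_ne_zero] at h
  rw [integral_const, smul_eq_mul, mul_one, measureReal_def, ENNReal.toReal_eq_one_iff] at h
  exact ⟨h⟩

/-- The orthonormal polynomials of the equilibrium measure: normalized Chebyshev polynomials of the
first kind. -/
noncomputable def chebyshevSystem (n : ℕ) : Polynomial ℝ :=
  if n = 0 then 1 else Polynomial.C √2 * Polynomial.Chebyshev.T ℝ n

open Polynomial.Chebyshev in
/-- The Chebyshev recurrence `x T_k = (T_{k+1} + T_{k-1}) / 2` gives `a_k = 1/2` and `b_k = 0` for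
`k ≥ 2`. -/
theorem isNevaiSystem_chebyshevSystem : IsNevaiSystem equilibriumMeasure chebyshevSystem := by
  have hort : ∀ i j, ∫ x, (chebyshevSystem i).eval x * (chebyshevSystem j).eval x
      ∂equilibriumMeasure = if i = j then 1 else 0 := by
    intro i j
    rw [integral_equilibriumMeasure]
    have h0 := integral_eval_T_real_mul_self_measureT_zero
    have h2 : √2 * √2 = (2 : ℝ) := Real.mul_self_sqrt (by norm_num)
    have hT : ∀ n : ℕ, ∃ c : ℝ, chebyshevSystem n = Polynomial.C c * T ℝ n ∧
        c * c = if n = 0 then 1 else 2 := by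
      intro n
      unfold chebyshevSystem
      split_ifs with hn
      · exact ⟨1, by simp [hn], by norm_num⟩
      · exact ⟨√2, rfl, h2⟩
    obtain ⟨c, hc, hcc⟩ := hT i
    obtain ⟨c', hc', -⟩ := hT j
    have h3 : ∀ x, (chebyshevSystem i).eval x * (chebyshevSystem j).eval x =
        c * c' * ((T ℝ i).eval x * (T ℝ j).eval x) := fun x => by
      rw [hc, hc', Polynomial.eval_mul, Polynomial.eval_mul, Polynomial.eval_C, Polynomial.eval_C]
      ring
    have hpi := Real.pi_ne_zero
    split_ifs with hij
    · subst hij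
      have h4 : ∀ x, (chebyshevSystem i).eval x * (chebyshevSystem i).eval x =
          c * c * ((T ℝ i).eval x * (T ℝ i).eval x) := fun x => by
        rw [hc, Polynomial.eval_mul, Polynomial.eval_C]
        ring
      simp_rw [h4, integral_const_mul, hcc]
      split_ifs with hi
      · subst hi
        rw [Nat.cast_zero, h0]
        field_simp
      · rw [integral_T_real_mul_self_measureT_of_ne_zero hi]
        field_simp
    · simp_rw [h3, integral_const_mul, integral_eval_T_real_mul_eval_T_real_measureT_of_ne hij]
      simp
  have hsys : IsOrthonormalSystem equilibriumMeasure chebyshevSystem := by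
    refine ⟨?_, fun n => ?_, fun n => ?_, hort⟩
    · rw [equilibriumMeasure, withDensity_apply _ measurableSet_Icc.compl]
      refine setLIntegral_eq_zero measurableSet_Icc.compl fun x hx => ?_
      simp [Set.indicator_of_notMem hx]
    · unfold chebyshevSystem
      split_ifs with h
      · simp [h]
      · rw [Polynomial.natDegree_C_mul (by simp)]
        simp
    · unfold chebyshevSystem
      split_ifs with h
      · simp 
      · simp
  have hrec : ∀ k x, x * (chebyshevSystem (k + 2)).eval x =
      1 / 2 * (chebyshevSystem (k + 3)).eval x + 1 / 2 * (chebyshevSystem (k + 1)).eval x := by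
    intro k x
    have h1 := congrArg (Polynomial.eval x) (T_add_two ℝ (k + 1))
    simp only [chebyshevSystem, Nat.add_eq_zero_iff, OfNat.ofNat_ne_zero, one_ne_zero, and_false,
      if_false, Polynomial.eval_mul, Polynomial.eval_C, Nat.cast_add, Nat.cast_ofNat, Nat.cast_one]
    rw [show (k : ℤ) + 3 = k + 1 + 2 by ring, h1, show (k : ℤ) + 1 + 1 = k + 2 by ring]
    simp only [Polynomial.eval_sub, Polynomial.eval_mul, Polynomial.eval_X, Polynomial.eval_ofNat]
    ring
  have hj : ∀ k l, jacobiPow equilibriumMeasure chebyshevSystem 1 (k + 2) l =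
      1 / 2 * (if k + 3 = l then 1 else 0) + 1 / 2 * (if k + 1 = l then 1 else 0) := by
    intro k l
    unfold jacobiPow
    simp_rw [pow_one, hrec, add_mul, mul_assoc]
    rw [integral_add (hsys.integrable (by fun_prop)) (hsys.integrable (by fun_prop)),
      integral_const_mul, integral_const_mul, hort, hort]
  refine ⟨hsys, ?_, ?_⟩
  · rw [← tendsto_add_atTop_iff_nat 2]
    simp [hj]
  · rw [← tendsto_add_atTop_iff_nat 2]
    simp [hj]

/-! ### Orthonormal polynomials of a product measure -/

/-- The tensor products of the one-dimensional orthonormal polynomials. -/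
noncomputable def tensorPoly {d : ℕ} (p : Fin d → ℕ → Polynomial ℝ) (α : MultiIndex d)
    (x : Fin d → ℝ) : ℝ := ∏ j, (p j (α j)).eval (x j)

@[fun_prop]
theorem continuous_tensorPoly {d : ℕ} (p : Fin d → ℕ → Polynomial ℝ) (α : MultiIndex d) :
    Continuous (tensorPoly p α) := by
  unfold tensorPoly
  fun_prop

theorem pi_compl_null {ι X : Type*} [Fintype ι] [MeasurableSpace X] {ν : ι → Measure X}
    [∀ j, IsProbabilityMeasure (ν j)] {K : Set X} (hK : MeasurableSet K)
    (h : ∀ j, ν j Kᶜ = 0) : Measure.pi ν (Set.pi Set.univ fun _ => K)ᶜ = 0 := by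
  rw [prob_compl_eq_zero_iff (MeasurableSet.univ_pi fun _ => hK), Measure.pi_pi]
  exact Finset.prod_eq_one fun j _ => (prob_compl_eq_zero_iff hK).1 (h j)

/-- The cube `[-1, 1]^d`. -/
def unitCube (d : ℕ) : Set (Fin d → ℝ) := Set.pi Set.univ fun _ => Set.Icc (-1) 1

theorem isCompact_unitCube (d : ℕ) : IsCompact (unitCube d) :=
  isCompact_univ_pi fun _ => isCompact_Icc

/-- The graded lexicographic order refines the coordinatewise order. -/
theorem MultiIndex.le_of_forall_le {d : ℕ} {α β : MultiIndex d} (h : ∀ j, α j ≤ β j) : α ≤ β := by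
  refine le_of_not_gt fun hlt => ?_
  have hm : α.maxNorm ≤ β.maxNorm := Finset.sup_mono_fun fun j _ => h j
  rcases (MultiIndex.lt_iff β α).1 hlt with h1 | ⟨-, j, -, h1⟩
  · omega
  · exact absurd (h j) (not_le.2 h1)

section Tensor

variable {d : ℕ} {ν : Fin d → Measure ℝ} [∀ j, IsProbabilityMeasure (ν j)]
  {p : Fin d → ℕ → Polynomial ℝ}

theorem pi_unitCube_compl (hp : ∀ j, IsOrthonormalSystem (ν j) (p j)) :
    Measure.pi ν (unitCube d)ᶜ = 0 :=
  pi_compl_null measurableSet_Icc fun j => (hp j).supported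

/-- Matrix entries of a monomial factor over the coordinates, by Fubini. -/
theorem integral_monomial_mul_tensorPoly (m : Fin d → ℕ) (α β : MultiIndex d) :
    ∫ x, (∏ j, x j ^ m j) * tensorPoly p α x * tensorPoly p β x ∂Measure.pi ν =
      ∏ j, jacobiPow (ν j) (p j) (m j) (α j) (β j) := by
  simp_rw [tensorPoly, ← Finset.prod_mul_distrib]
  exact integral_fintype_prod_eq_prod
    (fun j (t : ℝ) => t ^ m j * (p j (α j)).eval t * (p j (β j)).eval t)

theorem integral_tensorPoly_mul (hp : ∀ j, IsOrthonormalSystem (ν j) (p j))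
    (α β : MultiIndex d) : ∫ x, tensorPoly p α x * tensorPoly p β x ∂Measure.pi ν =
      if α = β then 1 else 0 := by
  have h := integral_monomial_mul_tensorPoly (ν := ν) (p := p) (fun _ => 0) α β
  simp only [pow_zero, Finset.prod_const_one, one_mul] at h
  rw [h]
  simp_rw [(hp _).jacobiPow_zero]
  split_ifs with hab
  · simp [hab]
  · obtain ⟨j, hj⟩ := Function.ne_iff.1 hab
    exact Finset.prod_eq_zero (Finset.mem_univ j) (if_neg hj)

/-- The multivariate orthonormal polynomials of a product measure are the tensor products of the
univariate ones, because the monomial `x^α` only involves the tensor products of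
exponents `β ≤ α`, which come before `α`. -/
theorem multiOrthoPoly_pi [NeZero d] (hp : ∀ j, IsOrthonormalSystem (ν j) (p j)) (k : ℕ) :
    multiOrthoPoly (Measure.pi ν) k = tensorPoly p (MultiIndex.enum d k) := by
  choose c hcpos hczero hc using fun j => (hp j).exists_triangular
  refine orthonormalized_eq (e := fun k => tensorPoly p (MultiIndex.enum d k))
    (c := fun n i => ∏ j, c j (MultiIndex.enum d n j) (MultiIndex.enum d i j))
    (fun i j => ?_) (fun i j => ?_) (fun n => Finset.prod_pos fun j _ => hcpos j _)
    (fun n x => ?_) k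
  · exact integrable_of_continuous_of_compl_null (isCompact_unitCube d) (pi_unitCube_compl hp)
      (by fun_prop)
  · rw [integral_tensorPoly_mul hp]
    simp
  · obtain ⟨α, hα⟩ : ∃ α : Fin d → ℕ, MultiIndex.enum d n = α := ⟨_, rfl⟩
    have hmono : ∏ j, x j ^ α j =
        ∏ j, ∑ i ∈ Finset.range (α j + 1), c j (α j) i * (p j i).eval (x j) :=
      Finset.prod_congr rfl fun j _ => hc j (α j) (x j)
    rw [hα]
    refine hmono.trans ?_
    rw [Finset.prod_univ_sum]
    simp_rw [tensorPoly, ← Finset.prod_mul_distrib]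
    -- The multi-indices below `α` coordinatewise are among the first `n + 1`.
    have himg : Fintype.piFinset (fun j => Finset.range (α j + 1)) ⊆
        ((Finset.range (n + 1)).map (MultiIndex.enum d).toEquiv.toEmbedding :
          Finset (Fin d → ℕ)) := by
      intro β hβ
      have hle : @LE.le (MultiIndex d) _ β (MultiIndex.enum d n) := by
        refine MultiIndex.le_of_forall_le fun j => ?_
        rw [hα]
        have := Finset.mem_range.1 (Fintype.mem_piFinset.1 hβ j)
        exact Nat.le_of_lt_succ this
      refine Finset.mem_map.2
        ⟨(MultiIndex.enum d).symm β, ?_, (MultiIndex.enum d).apply_symm_apply β⟩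
      rw [Finset.mem_range, Nat.lt_succ_iff]
      exact (MultiIndex.enum d).symm_apply_le.2 hle
    refine (Finset.sum_subset himg ?_).trans ?_
    · intro β _ hβ
      simp only [Fintype.mem_piFinset, not_forall, Finset.mem_range, not_lt] at hβ
      obtain ⟨j, hj⟩ := hβ
      refine Finset.prod_eq_zero (Finset.mem_univ j) ?_
      rw [hczero j _ _ (by omega), zero_mul]
    · exact Finset.sum_map _ _ _

end Tensor

/-! ### Determinantal ensembles -/

/-- If two permutations agree off `{a, b}`, they are equal or differ by the transposition. -/
theorem eq_or_eq_mul_swap {N : ℕ} {a b : Fin N} {σ τ : Equiv.Perm (Fin N)}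
    (h : ∀ i, i ≠ a → i ≠ b → σ i = τ i) : τ = σ ∨ τ = σ * Equiv.swap a b := by
  set ρ := σ⁻¹ * τ with hρ
  have hfix : ∀ i, i ≠ a → i ≠ b → ρ i = i := fun i ha hb => by
    rw [hρ, Equiv.Perm.mul_apply, ← h i ha hb]
    exact σ.symm_apply_apply i
  have hτ : τ = σ * ρ := by rw [hρ, mul_inv_cancel_left]
  have hmem : ∀ i, ρ i = i ∨ (i = a ∨ i = b) := fun i => by
    by_cases ha : i = a
    · exact Or.inr (Or.inl ha)
    · by_cases hb : i = b
      · exact Or.inr (Or.inr hb)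
      · exact Or.inl (hfix i ha hb)
  have himg : ∀ i, (i = a ∨ i = b) → (ρ i = a ∨ ρ i = b) := by
    intro i hi
    by_contra hcon
    rw [not_or] at hcon
    have := ρ.injective (hfix (ρ i) hcon.1 hcon.2)
    rw [this] at hcon
    tauto
  rw [hτ]
  rcases himg a (Or.inl rfl) with ha | ha
  · left
    have hb : ρ b = b := by
      rcases himg b (Or.inr rfl) with hb | hb
      · have := ρ.injective (hb.trans ha.symm)
        rw [this, ha]
      · exact hb
    have : ρ = 1 := by
      ext i
      rcases hmem i with h | rfl | rfl
      · rw [h]; rfl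
      · rw [ha]; rfl
      · rw [hb]; rfl
    rw [this, mul_one]
  · right
    congr 1
    have hb : ρ b = a := by
      rcases himg b (Or.inr rfl) with hb | hb
      · exact hb
      · have := ρ.injective (hb.trans ha.symm)
        rw [this, ha, this]
    ext i
    by_cases h1 : i = a
    · rw [h1, ha, Equiv.swap_apply_left]
    · by_cases h2 : i = b
      · rw [h2, hb, Equiv.swap_apply_right]
      · rw [hfix i h1 h2, Equiv.swap_apply_of_ne_of_ne h1 h2]

theorem sign_mul_self_cast {N : ℕ} (σ : Equiv.Perm (Fin N)) :
    ((Equiv.Perm.sign σ : ℤ) : ℝ) * ((Equiv.Perm.sign σ : ℤ) : ℝ) = 1 := by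
  rcases Int.units_eq_one_or (Equiv.Perm.sign σ) with h | h <;> simp [h]

section Determinantal

variable {X : Type*}

/-- The density `(1 / N!) det [K(x_i, x_l)]` of the determinantal ensemble with kernel
`K(x, y) = ∑_{k < N} φ_k(x) φ_k(y)`. -/
noncomputable def ensembleDensity (φ : ℕ → X → ℝ) (N : ℕ) (x : Fin N → X) : ℝ :=
  (N.factorial : ℝ)⁻¹ *
    (Matrix.of fun i l : Fin N => ∑ k ∈ Finset.range N, φ k (x i) * φ k (x l)).det

/-- The kernel matrix is `Φ Φᵀ` with `Φ = (φ_k(x_i))`, so its determinant is a square. -/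
theorem ensembleDensity_eq (φ : ℕ → X → ℝ) (N : ℕ) (x : Fin N → X) :
    ensembleDensity φ N x =
      (N.factorial : ℝ)⁻¹ * (Matrix.of fun i k : Fin N => φ k (x i)).det ^ 2 := by
  rw [ensembleDensity, pow_two]
  congr 1
  rw [show (Matrix.of fun i l : Fin N => ∑ k ∈ Finset.range N, φ k (x i) * φ k (x l)) =
      (Matrix.of fun i k : Fin N => φ k (x i)) *
        (Matrix.of fun i k : Fin N => φ k (x i)).transpose by
    ext i l
    simp [Matrix.mul_apply, Finset.sum_range], Matrix.det_mul, Matrix.det_transpose]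

theorem ensembleDensity_nonneg (φ : ℕ → X → ℝ) (N : ℕ) (x : Fin N → X) :
    0 ≤ ensembleDensity φ N x := by
  rw [ensembleDensity_eq]; positivity

theorem ensembleDensity_eq_sum (φ : ℕ → X → ℝ) (N : ℕ) (x : Fin N → X) :
    ensembleDensity φ N x = (N.factorial : ℝ)⁻¹ *
      ∑ σ : Equiv.Perm (Fin N), ∑ τ : Equiv.Perm (Fin N),
        ((Equiv.Perm.sign σ : ℤ) : ℝ) * ((Equiv.Perm.sign τ : ℤ) : ℝ) *
          ∏ i, (φ (σ i) (x i) * φ (τ i) (x i)) := by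
  rw [ensembleDensity_eq, ← Matrix.det_transpose, pow_two, Matrix.det_apply', Finset.sum_mul_sum]
  congr 1
  refine Finset.sum_congr rfl fun σ _ => Finset.sum_congr rfl fun τ _ => ?_
  simp only [Matrix.transpose_apply, Matrix.of_apply, Finset.prod_mul_distrib]
  ring

theorem continuous_ensembleDensity [TopologicalSpace X] {φ : ℕ → X → ℝ} (hφ : ∀ k, Continuous (φ k))
    (N : ℕ) : Continuous (ensembleDensity φ N) := by
  unfold ensembleDensity
  refine continuous_const.mul (Continuous.matrix_det ?_)
  fun_prop

variable [MeasurableSpace X]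

/-- The determinantal ensemble with reference measure `ν` and kernel
`K(x, y) = ∑_{k < N} φ_k(x) φ_k(y)`. -/
noncomputable def ensemble (ν : Measure X) (φ : ℕ → X → ℝ) (N : ℕ) : Measure (Fin N → X) :=
  (Measure.pi fun _ : Fin N => ν).withDensity fun x => ENNReal.ofReal (ensembleDensity φ N x)

/-- The matrix entry `⟨f φ_k, φ_l⟩` in `L²(ν)`. -/
noncomputable def matrixEntry (ν : Measure X) (φ : ℕ → X → ℝ) (f : X → ℝ) (k l : ℕ) : ℝ :=
  ∫ x, f x * φ k x * φ l x ∂ν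

theorem matrixEntry_comm (ν : Measure X) (φ : ℕ → X → ℝ) (f : X → ℝ) (k l : ℕ) :
    matrixEntry ν φ f k l = matrixEntry ν φ f l k := by
  unfold matrixEntry
  congr 1; ext x; ring

/-- Continuous functions `φ 0, φ 1, …`, orthonormal for a measure `ν` carried by the compact set
`K`. -/
structure IsCompactlyOrthonormal [TopologicalSpace X] (ν : Measure X) (K : Set X)
    (φ : ℕ → X → ℝ) : Prop where
  isCompact : IsCompact K
  compl_null : ν Kᶜ = 0
  continuous : ∀ k, Continuous (φ k)
  integral_mul : ∀ i j, ∫ x, φ i x * φ j x ∂ν = if i = j then 1 else 0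

variable [TopologicalSpace X] [BorelSpace X] [SecondCountableTopology X]
  {ν : Measure X} {K : Set X} {φ : ℕ → X → ℝ}

theorem integral_ensemble (hφ : ∀ k, Continuous (φ k)) [SigmaFinite ν] (N : ℕ)
    (F : (Fin N → X) → ℝ) :
    ∫ x, F x ∂ensemble ν φ N =
      ∫ x, ensembleDensity φ N x * F x ∂Measure.pi fun _ : Fin N => ν := by
  rw [ensemble, integral_withDensity_eq_integral_toReal_smul
    (continuous_ensembleDensity hφ N).measurable.ennreal_ofReal
    (ae_of_all _ fun x => ENNReal.ofReal_lt_top)]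
  simp_rw [ENNReal.toReal_ofReal (ensembleDensity_nonneg φ N _), smul_eq_mul]

variable [T2Space X] [IsProbabilityMeasure ν]

theorem integrable_pi_of_continuous (H : IsCompactlyOrthonormal ν K φ) {N : ℕ}
    {F : (Fin N → X) → ℝ} (hF : Continuous F) : Integrable F (Measure.pi fun _ : Fin N => ν) :=
  integrable_of_continuous_of_compl_null (isCompact_univ_pi fun _ => H.isCompact)
    (pi_compl_null H.isCompact.measurableSet fun _ => H.compl_null) hF

/-- Expectation of a product of one-point functions: Leibniz's formula turns it into a sum of
products of one-point integrals. -/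
theorem integral_ensemble_prod (H : IsCompactlyOrthonormal ν K φ)
    (N : ℕ) (h : Fin N → X → ℝ) (hh : ∀ i, Continuous (h i)) :
    ∫ x, ∏ i, h i (x i) ∂ensemble ν φ N = (N.factorial : ℝ)⁻¹ *
      ∑ σ : Equiv.Perm (Fin N), ∑ τ : Equiv.Perm (Fin N),
        ((Equiv.Perm.sign σ : ℤ) : ℝ) * ((Equiv.Perm.sign τ : ℤ) : ℝ) *
          ∏ i, ∫ x, h i x * φ (σ i) x * φ (τ i) x ∂ν := by
  have hφ := H.continuous
  rw [integral_ensemble hφ]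
  have h1 : ∀ x : Fin N → X, ensembleDensity φ N x * ∏ i, h i (x i) = (N.factorial : ℝ)⁻¹ *
      ∑ σ : Equiv.Perm (Fin N), ∑ τ : Equiv.Perm (Fin N),
        ((Equiv.Perm.sign σ : ℤ) : ℝ) * ((Equiv.Perm.sign τ : ℤ) : ℝ) *
          ∏ i, (h i (x i) * φ (σ i) (x i) * φ (τ i) (x i)) := by
    intro x
    rw [ensembleDensity_eq_sum, mul_assoc, Finset.sum_mul]
    congr 1
    refine Finset.sum_congr rfl fun σ _ => ?_
    rw [Finset.sum_mul]
    refine Finset.sum_congr rfl fun τ _ => ?_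
    simp only [Finset.prod_mul_distrib]
    ring
  simp_rw [h1]
  rw [integral_const_mul]
  congr 1
  have hi : ∀ σ τ : Equiv.Perm (Fin N), Integrable (fun x : Fin N → X =>
      ((Equiv.Perm.sign σ : ℤ) : ℝ) * ((Equiv.Perm.sign τ : ℤ) : ℝ) *
        ∏ i, (h i (x i) * φ (σ i) (x i) * φ (τ i) (x i))) (Measure.pi fun _ : Fin N => ν) :=
    fun σ τ => integrable_pi_of_continuous H (by fun_prop)
  rw [integral_finsetSum _ fun σ _ => integrable_finsetSum _ fun τ _ => hi σ τ]
  refine Finset.sum_congr rfl fun σ _ => ?_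
  rw [integral_finsetSum _ fun τ _ => hi σ τ]
  refine Finset.sum_congr rfl fun τ _ => ?_
  rw [integral_const_mul]
  congr 1
  exact integral_fintype_prod_eq_prod fun i x => h i x * φ (σ i) x * φ (τ i) x

/-- One-point expectation: only the diagonal terms `σ = τ` of the Leibniz expansion survive. The sum
over `σ` is kept, so that summing over `a` later needs only a reindexing by `σ`. -/
theorem integral_ensemble_apply (H : IsCompactlyOrthonormal ν K φ) {N : ℕ} {f : X → ℝ}
    (hf : Continuous f) (a : Fin N) :
    ∫ x, f (x a) ∂ensemble ν φ N = (N.factorial : ℝ)⁻¹ *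
      ∑ σ : Equiv.Perm (Fin N), matrixEntry ν φ f (σ a) (σ a) := by
  have h := integral_ensemble_prod H N (Function.update (fun _ _ => 1) a f) fun i => by
    rcases eq_or_ne i a with rfl | hi
    · rwa [Function.update_self]
    · rw [Function.update_of_ne hi]; exact continuous_const
  have h1 : ∀ x : Fin N → X, ∏ i, (Function.update (fun _ _ => 1) a f : Fin N → X → ℝ) i (x i) =
      f (x a) := fun x => by
    rw [Fintype.prod_eq_single a, Function.update_self]
    intro i hi
    rw [Function.update_of_ne hi]
  simp_rw [h1] at h
  rw [h]
  congr 1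
  refine Finset.sum_congr rfl fun σ _ => ?_
  have hoff : ∀ (τ : Equiv.Perm (Fin N)) (i : Fin N), i ≠ a →
      ∫ x, (Function.update (fun _ _ => 1) a f : Fin N → X → ℝ) i x * φ (σ i) x * φ (τ i) x ∂ν =
        if σ i = τ i then 1 else 0 := fun τ i hi => by
    simp_rw [Function.update_of_ne hi, one_mul, H.integral_mul, Fin.val_inj]
  rw [Finset.sum_eq_single σ]
  · rw [sign_mul_self_cast, one_mul, Fintype.prod_eq_single a, Function.update_self]
    · rfl
    · intro i hi
      rw [hoff σ i hi, if_pos rfl]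
  · intro τ _ hτ
    have hex : ∃ i, i ≠ a ∧ σ i ≠ τ i := by
      by_contra hcon
      push Not at hcon
      rcases eq_or_eq_mul_swap (a := a) (b := a) (fun i hi _ => hcon i hi) with h | h
      · exact hτ h
      · rw [Equiv.swap_self] at h
        exact hτ h
    obtain ⟨i, hi, hne⟩ := hex
    rw [Finset.prod_eq_zero (Finset.mem_univ i), mul_zero]
    rw [hoff τ i hi, if_neg hne]
  · simp

/-- Two-point expectation: the terms `τ = σ` and `τ = σ ∘ (a b)` of the Leibniz expansion survive,
the latter with a minus sign. -/
theorem integral_ensemble_apply_mul_apply (H : IsCompactlyOrthonormal ν K φ) {N : ℕ}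
    {f g : X → ℝ} (hf : Continuous f) (hg : Continuous g) {a b : Fin N} (hab : a ≠ b) :
    ∫ x, f (x a) * g (x b) ∂ensemble ν φ N = (N.factorial : ℝ)⁻¹ *
      ∑ σ : Equiv.Perm (Fin N), (matrixEntry ν φ f (σ a) (σ a) * matrixEntry ν φ g (σ b) (σ b) -
        matrixEntry ν φ f (σ a) (σ b) * matrixEntry ν φ g (σ a) (σ b)) := by
  obtain ⟨h, ha, hb, hh⟩ : ∃ h : Fin N → X → ℝ, h a = f ∧ h b = g ∧
      ∀ i, i ≠ a → i ≠ b → h i = fun _ => 1 :=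
    ⟨Function.update (Function.update (fun _ _ => 1) b g) a f, by simp, by
      rw [Function.update_of_ne hab.symm, Function.update_self], fun i h1 h2 => by
      rw [Function.update_of_ne h1, Function.update_of_ne h2]⟩
  have hcont : ∀ i, Continuous (h i) := fun i => by
    by_cases h1 : i = a
    · rwa [h1, ha]
    · by_cases h2 : i = b
      · rwa [h2, hb]
      · rw [hh i h1 h2]; exact continuous_const
  have hint := integral_ensemble_prod H N h hcont
  have h1 : ∀ x : Fin N → X, ∏ i, h i (x i) = f (x a) * g (x b) := fun x => by
    rw [Fintype.prod_eq_mul a b hab, ha, hb]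
    rintro i ⟨h1, h2⟩
    rw [hh i h1 h2]
  simp_rw [h1] at hint
  rw [hint]
  congr 1
  refine Finset.sum_congr rfl fun σ _ => ?_
  have hoff : ∀ (τ : Equiv.Perm (Fin N)) (i : Fin N), i ≠ a → i ≠ b →
      ∫ x, h i x * φ (σ i) x * φ (τ i) x ∂ν = if σ i = τ i then 1 else 0 := fun τ i h1 h2 => by
    simp_rw [hh i h1 h2, one_mul, H.integral_mul, Fin.val_inj]
  have hne : σ ≠ σ * Equiv.swap a b := by
    intro h
    have := congrArg (fun ρ : Equiv.Perm (Fin N) => ρ a) h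
    simp only [Equiv.Perm.mul_apply, Equiv.swap_apply_left] at this
    exact hab (σ.injective this)
  rw [Fintype.sum_eq_add σ (σ * Equiv.swap a b) hne]
  · rw [sign_mul_self_cast, one_mul, Fintype.prod_eq_mul a b hab, ha, hb,
      Fintype.prod_eq_mul a b hab, ha, hb]
    · rw [Equiv.Perm.sign_mul, Equiv.Perm.sign_swap hab]
      have hs := sign_mul_self_cast σ
      simp only [Equiv.Perm.mul_apply, Equiv.swap_apply_left, Equiv.swap_apply_right]
      rw [matrixEntry_comm ν φ g (σ a) (σ b)]
      simp only [matrixEntry]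
      push_cast
      linear_combination (-(∫ x, f x * φ (σ a) x * φ (σ b) x ∂ν) *
        ∫ x, g x * φ (σ b) x * φ (σ a) x ∂ν) * hs
    · rintro i ⟨h1, h2⟩
      rw [hoff _ i h1 h2, Equiv.Perm.mul_apply, Equiv.swap_apply_of_ne_of_ne h1 h2, if_pos rfl]
    · rintro i ⟨h1, h2⟩
      rw [hoff _ i h1 h2, if_pos rfl]
  · rintro τ ⟨h1, h2⟩
    have hex : ∃ i, i ≠ a ∧ i ≠ b ∧ σ i ≠ τ i := by
      by_contra hcon
      push Not at hcon
      rcases eq_or_eq_mul_swap (a := a) (b := b) hcon with h | h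
      · exact h1 h
      · exact h2 h
    obtain ⟨i, hia, hib, hne⟩ := hex
    rw [Finset.prod_eq_zero (Finset.mem_univ i), mul_zero]
    rw [hoff τ i hia hib, if_neg hne]

/-- By orthonormality, the total mass is `1 / N!` times the number of permutations. -/
theorem isProbabilityMeasure_ensemble (H : IsCompactlyOrthonormal ν K φ) (N : ℕ) :
    IsProbabilityMeasure (ensemble ν φ N) := by
  have h := integral_ensemble_prod H N (fun _ _ => 1) fun _ => continuous_const
  have hN : (N.factorial : ℝ) ≠ 0 := by exact_mod_cast N.factorial_ne_zero
  have h1 : ∀ σ : Equiv.Perm (Fin N), ∑ τ : Equiv.Perm (Fin N),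
      ((Equiv.Perm.sign σ : ℤ) : ℝ) * ((Equiv.Perm.sign τ : ℤ) : ℝ) *
        ∏ i, ∫ x, 1 * φ (σ i) x * φ (τ i) x ∂ν = 1 := by
    intro σ
    simp_rw [one_mul, H.integral_mul, Fin.val_inj]
    rw [Finset.sum_eq_single σ]
    · simp [sign_mul_self_cast]
    · intro τ _ hτ
      obtain ⟨i, hi⟩ := DFunLike.ne_iff.1 hτ
      rw [Finset.prod_eq_zero (Finset.mem_univ i) (if_neg hi.symm), mul_zero]
    · simp
  simp_rw [h1] at h
  rw [Finset.sum_const, Finset.card_univ, Fintype.card_perm, Fintype.card_fin, nsmul_eq_mul,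
    mul_one, inv_mul_cancel₀ hN, integral_ensemble H.continuous] at h
  simp only [Finset.prod_const_one, mul_one] at h
  refine ⟨?_⟩
  rw [ensemble, withDensity_apply _ MeasurableSet.univ, Measure.restrict_univ,
    ← ofReal_integral_eq_lintegral_ofReal
      (integrable_pi_of_continuous H (continuous_ensembleDensity H.continuous N))
      (ae_of_all _ fun x => ensembleDensity_nonneg φ N x), h, ENNReal.ofReal_one]

theorem memLp_ensemble (H : IsCompactlyOrthonormal ν K φ) (N : ℕ) {F : (Fin N → X) → ℝ}
    (hF : Continuous F) (q : ENNReal) : MemLp F q (ensemble ν φ N) := by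
  have := isProbabilityMeasure_ensemble H N
  obtain ⟨C, hC⟩ := (isCompact_univ_pi fun _ : Fin N => H.isCompact).exists_bound_of_continuousOn
    hF.continuousOn
  refine MemLp.of_bound hF.aestronglyMeasurable C ?_
  have hac : ensemble ν φ N ≪ Measure.pi fun _ : Fin N => ν := withDensity_absolutelyContinuous _ _
  have hae : ∀ᵐ x ∂Measure.pi fun _ : Fin N => ν, x ∈ Set.pi Set.univ fun _ => K :=
    pi_compl_null H.isCompact.measurableSet fun _ => H.compl_null
  filter_upwards [hac.ae_le hae] with x hx using hC x hx

theorem integrable_ensemble (H : IsCompactlyOrthonormal ν K φ) (N : ℕ) {F : (Fin N → X) → ℝ}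
    (hF : Continuous F) : Integrable F (ensemble ν φ N) :=
  memLp_one_iff_integrable.1 (memLp_ensemble H N hF 1)

/-- Covariance of two linear statistics of a determinantal ensemble. The diagonal terms `k = l`
cancel in the two-point determinant, so the double sum may run over all `k, l < N`. -/
theorem covariance_ensemble (H : IsCompactlyOrthonormal ν K φ) (N : ℕ) {f g : X → ℝ}
    (hf : Continuous f) (hg : Continuous g) :
    cov[fun x => ∑ i, f (x i), fun x => ∑ i, g (x i); ensemble ν φ N] =
      ∑ k ∈ Finset.range N, (matrixEntry ν φ (fun x => f x * g x) k k -
        ∑ l ∈ Finset.range N, matrixEntry ν φ f k l * matrixEntry ν φ g k l) := by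
  have hprob := isProbabilityMeasure_ensemble H N
  have hN : (N.factorial : ℝ) ≠ 0 := by exact_mod_cast N.factorial_ne_zero
  have hcard : ∀ c : ℝ, (N.factorial : ℝ)⁻¹ * ∑ _σ : Equiv.Perm (Fin N), c = c := fun c => by
    rw [Finset.sum_const, Finset.card_univ, Fintype.card_perm, Fintype.card_fin, nsmul_eq_mul,
      inv_mul_cancel_left₀ hN]
  have hmean : ∀ {u : X → ℝ}, Continuous u → ∫ x, ∑ i, u (x i) ∂ensemble ν φ N =
      ∑ k : Fin N, matrixEntry ν φ u k k := fun {u} hu => by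
    rw [integral_finsetSum _ fun i _ => integrable_ensemble H N (by fun_prop)]
    simp_rw [integral_ensemble_apply H hu]
    rw [← Finset.mul_sum, Finset.sum_comm]
    simp_rw [Equiv.sum_comp _ fun k : Fin N => matrixEntry ν φ u k k]
    exact hcard _
  have hpair : ∫ x, (∑ i, f (x i)) * (∑ i, g (x i)) ∂ensemble ν φ N =
      ∑ k : Fin N, ∑ l : Fin N, ((matrixEntry ν φ f k k * matrixEntry ν φ g l l -
        matrixEntry ν φ f k l * matrixEntry ν φ g k l) +
        if k = l then matrixEntry ν φ (fun x => f x * g x) k k else 0) := by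
    simp_rw [Finset.sum_mul_sum]
    rw [integral_finsetSum _ fun i _ => integrable_ensemble H N (by fun_prop)]
    have h2 : ∀ a b : Fin N, ∫ x, f (x a) * g (x b) ∂ensemble ν φ N = (N.factorial : ℝ)⁻¹ *
        ∑ σ : Equiv.Perm (Fin N),
          ((matrixEntry ν φ f (σ a) (σ a) * matrixEntry ν φ g (σ b) (σ b) -
            matrixEntry ν φ f (σ a) (σ b) * matrixEntry ν φ g (σ a) (σ b)) +
          if σ a = σ b then matrixEntry ν φ (fun x => f x * g x) (σ a) (σ a) else 0) := by
      intro a b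
      by_cases hab : a = b
      · subst hab
        simpa using integral_ensemble_apply H (f := fun x => f x * g x) (by fun_prop) a
      · rw [integral_ensemble_apply_mul_apply H hf hg hab]
        simp [hab]
    have h3 : ∀ a : Fin N, ∫ x, ∑ b, f (x a) * g (x b) ∂ensemble ν φ N =
        ∑ b, ∫ x, f (x a) * g (x b) ∂ensemble ν φ N := fun a =>
      integral_finsetSum _ fun i _ => integrable_ensemble H N (by fun_prop)
    simp_rw [h3, h2, ← Finset.mul_sum]
    -- For each `σ`, summing over `(a, b)` is summing over `(k, l) = (σ a, σ b)`; then averaging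
    -- over `σ` changes nothing.
    set G : Fin N → Fin N → ℝ := fun k l => (matrixEntry ν φ f k k * matrixEntry ν φ g l l -
        matrixEntry ν φ f k l * matrixEntry ν φ g k l) +
        if k = l then matrixEntry ν φ (fun x => f x * g x) k k else 0 with hG
    change (N.factorial : ℝ)⁻¹ * ∑ a, ∑ b, ∑ σ : Equiv.Perm (Fin N), G (σ a) (σ b) =
      ∑ k, ∑ l, G k l
    have h4 : ∀ a, ∑ b, ∑ σ : Equiv.Perm (Fin N), G (σ a) (σ b) =
        ∑ σ : Equiv.Perm (Fin N), ∑ l, G (σ a) l := fun a => by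
      rw [Finset.sum_comm]
      exact Finset.sum_congr rfl fun σ _ => Equiv.sum_comp σ fun l => G (σ a) l
    simp_rw [h4]
    rw [Finset.sum_comm]
    simp_rw [Equiv.sum_comp _ fun k => ∑ l, G k l]
    exact hcard _
  rw [covariance_eq_sub (memLp_ensemble H N (by fun_prop) 2)
    (memLp_ensemble H N (by fun_prop) 2)]
  simp only [Pi.mul_apply]
  rw [hpair, hmean hf, hmean hg, Finset.sum_mul_sum]
  simp only [Finset.sum_add_distrib, Finset.sum_sub_distrib, Finset.sum_ite_eq, Finset.mem_univ,
    if_true, Finset.sum_range]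
  ring

end Determinantal

/-! ### Sums over shells of cubes -/

theorem sum_piFinset_apply_eq {ι : Type*} [Fintype ι] [DecidableEq ι] (t : ι → Finset ℕ)
    (f : ℕ → ℝ) (j : ι) : ∑ α ∈ Fintype.piFinset t, f (α j) =
      (∏ k ∈ Finset.univ.erase j, ((t k).card : ℝ)) * ∑ a ∈ t j, f a := by
  have h := Finset.prod_univ_sum t fun k a => if k = j then f a else 1
  have h1 : ∀ α : ι → ℕ, ∏ k, (if k = j then f (α k) else 1) = f (α j) := fun α => by
    simp [Finset.prod_ite_eq']
  simp_rw [h1] at h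
  rw [← h, ← Finset.prod_erase_mul _ _ (Finset.mem_univ j)]
  congr 1
  · refine Finset.prod_congr rfl fun k hk => ?_
    simp [Finset.ne_of_mem_erase hk]
  · simp

theorem sum_biUnion_le {ι κ : Type*} [DecidableEq ι] [DecidableEq κ] (s : Finset ι)
    (t : ι → Finset κ) {f : κ → ℝ} (hf : ∀ a, 0 ≤ f a) :
    ∑ a ∈ s.biUnion t, f a ≤ ∑ i ∈ s, ∑ a ∈ t i, f a := by
  induction s using Finset.induction_on with
  | empty => simp
  | insert i s hi ih =>
    rw [Finset.biUnion_insert, Finset.sum_insert hi]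
    have h1 := Finset.sum_union_inter (s₁ := t i) (s₂ := s.biUnion t) (f := f)
    have h2 : 0 ≤ ∑ a ∈ t i ∩ s.biUnion t, f a := Finset.sum_nonneg fun a _ => hf a
    linarith

/-- The multi-indices of sup norm at most `n` that have a coordinate in `[n - M, n]` (truncated
subtraction), as a union of `d` boxes. -/
noncomputable def shell (d M n : ℕ) : Finset (Fin d → ℕ) :=
  Finset.univ.biUnion fun i : Fin d =>
    Fintype.piFinset (Function.update (fun _ => Finset.range (n + 1)) i (Finset.Icc (n - M) n))

theorem mem_shell {d M n : ℕ} {α : Fin d → ℕ} (h : ∀ j, α j ≤ n) {i : Fin d} (hi : n ≤ α i + M) :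
    α ∈ shell d M n := by
  refine Finset.mem_biUnion.2 ⟨i, Finset.mem_univ i, Fintype.mem_piFinset.2 fun j => ?_⟩
  rcases eq_or_ne j i with rfl | hj
  · rw [Function.update_self, Finset.mem_Icc]
    exact ⟨by omega, h j⟩
  · rw [Function.update_of_ne hj, Finset.mem_range]
    exact Nat.lt_succ_of_le (h j)

/-- The two ways in which a coordinate `α_j` runs through a face of the shell: it is the coordinate
close to `n` (first term), or it is free (second term, a Cesàro mean). -/
noncomputable def shellError (ε : ℕ → ℝ) (M n : ℕ) : ℝ :=
  ∑ a ∈ Finset.Icc (n - M) n, ε a +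
    (M + 1) * (((n : ℝ) + 1)⁻¹ * ∑ a ∈ Finset.range (n + 1), ε a)

theorem tendsto_shellError {ε : ℕ → ℝ} (hε : Tendsto ε atTop (𝓝 0)) (M : ℕ) :
    Tendsto (shellError ε M) atTop (𝓝 0) := by
  have h1 : Tendsto (fun n : ℕ => ∑ a ∈ Finset.Icc (n - M) n, ε a) atTop (𝓝 0) := by
    rw [← tendsto_add_atTop_iff_nat M]
    have h : ∀ n, ∑ a ∈ Finset.Icc (n + M - M) (n + M), ε a =
        ∑ k ∈ Finset.range (M + 1), ε (n + k) := by
      intro n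
      rw [Nat.add_sub_cancel, ← Finset.Ico_succ_right_eq_Icc, Finset.sum_Ico_eq_sum_range]
      congr 2
      simp only [Order.succ_eq_add_one]
      omega
    simp_rw [h]
    rw [← Finset.sum_const_zero (s := Finset.range (M + 1)) (M := ℝ)]
    exact tendsto_finsetSum _ fun k _ => hε.comp (tendsto_add_atTop_nat k)
  have h2 := (hε.cesaro.comp (tendsto_add_atTop_nat 1)).const_mul ((M : ℝ) + 1)
  have h3 := h1.add h2
  rw [mul_zero, add_zero] at h3
  refine h3.congr fun n => ?_
  simp [shellError]

/-- The sum of `ε (α_j)` over the face of the shell where `α_i` is close to `n`. -/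
theorem sum_face_le {d M n : ℕ} {ε : ℕ → ℝ} (hε : ∀ a, 0 ≤ ε a) (i j : Fin d) :
    ∑ α ∈ Fintype.piFinset (Function.update (fun _ => Finset.range (n + 1)) i
      (Finset.Icc (n - M) n)), ε (α j) ≤ ((n : ℝ) + 1) ^ (d - 1) * shellError ε M n := by
  have hn : (0 : ℝ) < (n : ℝ) + 1 := by positivity
  have hs1 : 0 ≤ ∑ a ∈ Finset.Icc (n - M) n, ε a := Finset.sum_nonneg fun a _ => hε a
  have hs2 : 0 ≤ ∑ a ∈ Finset.range (n + 1), ε a := Finset.sum_nonneg fun a _ => hε a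
  rw [sum_piFinset_apply_eq]
  have hcard : ∀ k, k ≠ i → (((Function.update (fun _ => Finset.range (n + 1)) i
      (Finset.Icc (n - M) n) : Fin d → Finset ℕ) k).card : ℝ) = n + 1 := fun k hk => by
    rw [Function.update_of_ne hk, Finset.card_range]; push_cast; rfl
  rcases eq_or_ne j i with rfl | hji
  · rw [Finset.prod_congr rfl fun k hk => hcard k (Finset.ne_of_mem_erase hk), Finset.prod_const,
      Finset.card_erase_of_mem (Finset.mem_univ j), Finset.card_univ, Fintype.card_fin,
      Function.update_self, shellError]
    gcongr
    exact le_add_of_nonneg_right (by positivity)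
  · have hmem : i ∈ Finset.univ.erase j := Finset.mem_erase.2 ⟨hji.symm, Finset.mem_univ i⟩
    rw [← Finset.mul_prod_erase _ _ hmem,
      Finset.prod_congr rfl fun k hk => hcard k (Finset.ne_of_mem_erase hk), Finset.prod_const,
      Finset.card_erase_of_mem hmem, Finset.card_erase_of_mem (Finset.mem_univ j),
      Finset.card_univ, Fintype.card_fin, Function.update_self, Function.update_of_ne hji,
      Nat.card_Icc]
    have hd : 2 ≤ d := by
      have := i.2; have := j.2
      have : (i : ℕ) ≠ j := fun h => hji (Fin.ext h.symm)
      omega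
    have hle : ((n + 1 - (n - M) : ℕ) : ℝ) ≤ M + 1 := by
      exact_mod_cast (by omega : n + 1 - (n - M) ≤ M + 1)
    calc ((n + 1 - (n - M) : ℕ) : ℝ) * ((n : ℝ) + 1) ^ (d - 1 - 1) *
          ∑ a ∈ Finset.range (n + 1), ε a
        ≤ (M + 1) * ((n : ℝ) + 1) ^ (d - 1 - 1) * ∑ a ∈ Finset.range (n + 1), ε a := by gcongr
      _ = ((n : ℝ) + 1) ^ (d - 1) *
          ((M + 1) * (((n : ℝ) + 1)⁻¹ * ∑ a ∈ Finset.range (n + 1), ε a)) := by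
        rw [show d - 1 = d - 1 - 1 + 1 by omega, pow_succ, Nat.add_sub_cancel]
        field_simp
      _ ≤ _ := by
        rw [shellError]
        gcongr
        exact le_add_of_nonneg_left hs1

theorem sum_shell_le {d M n : ℕ} {ε : ℕ → ℝ} (hε : ∀ a, 0 ≤ ε a) (j : Fin d) :
    ∑ α ∈ shell d M n, ε (α j) ≤ d * (((n : ℝ) + 1) ^ (d - 1) * shellError ε M n) := by
  calc ∑ α ∈ shell d M n, ε (α j) ≤ ∑ i : Fin d, ∑ α ∈ Fintype.piFinset (Function.update
        (fun _ => Finset.range (n + 1)) i (Finset.Icc (n - M) n)), ε (α j) :=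
        sum_biUnion_le _ _ fun α => hε (α j)
    _ ≤ ∑ _i : Fin d, ((n : ℝ) + 1) ^ (d - 1) * shellError ε M n :=
        Finset.sum_le_sum fun i _ => sum_face_le hε i j
    _ = _ := by simp

/-! ### Initial segments of the graded lexicographic order -/

section InitialSegment

variable (d : ℕ) [NeZero d]

/-- The enumeration of the exponents, as a bijection onto `Fin d → ℕ`. -/
noncomputable def exponent : ℕ ≃ (Fin d → ℕ) := (MultiIndex.enum d).toEquiv

/-- The first `N` exponents in the graded lexicographic order. -/
noncomputable def firstExponents (N : ℕ) : Finset (Fin d → ℕ) :=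
  (Finset.range N).map (exponent d).toEmbedding

/-- The sup norm of the exponent with number `N`. -/
noncomputable def exponentNorm (N : ℕ) : ℕ := Finset.univ.sup (exponent d N)

variable {d}

theorem mem_firstExponents {N : ℕ} {α : Fin d → ℕ} :
    α ∈ firstExponents d N ↔ (exponent d).symm α < N := by
  simp [firstExponents, Finset.mem_map_equiv]

theorem monotone_exponentNorm : Monotone (exponentNorm d) := fun _ _ h =>
  MultiIndex.maxNorm_mono ((MultiIndex.enum d).monotone h)

theorem le_exponentNorm_of_mem {N : ℕ} {α : Fin d → ℕ} (h : α ∈ firstExponents d N) (j : Fin d) :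
    α j ≤ exponentNorm d N := by
  refine le_trans ?_ (monotone_exponentNorm (mem_firstExponents.1 h).le)
  rw [exponentNorm, Equiv.apply_symm_apply]
  exact Finset.le_sup (f := α) (Finset.mem_univ j)

/-- The first `N` exponents contain the open cube whose side is the sup norm of the next one. -/
theorem mem_firstExponents_of_lt {N : ℕ} {α : Fin d → ℕ} (h : ∀ j, α j < exponentNorm d N) :
    α ∈ firstExponents d N := by
  rw [mem_firstExponents]
  by_contra hcon
  have h1 := monotone_exponentNorm (d := d) (not_lt.1 hcon)
  rw [exponentNorm, exponentNorm, Equiv.apply_symm_apply] at h1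
  have h2 : Finset.univ.sup α < exponentNorm d N :=
    (Finset.sup_lt_iff (lt_of_le_of_lt (Nat.zero_le _) (h 0))).2 fun j _ => h j
  exact absurd h1 (not_le.2 h2)

theorem exponentNorm_pow_le (N : ℕ) : exponentNorm d N ^ d ≤ N := by
  have h : Fintype.piFinset (fun _ : Fin d => Finset.range (exponentNorm d N)) ⊆
      firstExponents d N := fun α hα => mem_firstExponents_of_lt fun j =>
    Finset.mem_range.1 (Fintype.mem_piFinset.1 hα j)
  simpa [firstExponents] using Finset.card_le_card h

theorem tendsto_exponentNorm : Tendsto (exponentNorm d) atTop atTop := by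
  refine tendsto_atTop_atTop_of_monotone monotone_exponentNorm fun b =>
    ⟨(exponent d).symm fun _ => b, ?_⟩
  rw [exponentNorm, Equiv.apply_symm_apply]
  exact Finset.le_sup (f := fun _ : Fin d => b) (Finset.mem_univ 0)

/-- The scaling `N^(1 - 1/d)` dominates the surface `n^(d - 1)` of the cube of side `n`. -/
theorem exponentNorm_pow_le_rpow (N : ℕ) :
    (exponentNorm d N : ℝ) ^ (d - 1) ≤ (N : ℝ) ^ (1 - 1 / (d : ℝ)) := by
  have hd : (1 : ℝ) ≤ d := by exact_mod_cast Nat.one_le_iff_ne_zero.2 (NeZero.ne d)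
  have h0 : (0 : ℝ) ≤ exponentNorm d N := Nat.cast_nonneg _
  calc (exponentNorm d N : ℝ) ^ (d - 1)
      = ((exponentNorm d N : ℝ) ^ d) ^ (1 - 1 / (d : ℝ)) := by
        rw [← Real.rpow_natCast, ← Real.rpow_natCast, ← Real.rpow_mul h0,
          Nat.cast_pred (Nat.pos_of_ne_zero (NeZero.ne d))]
        congr 1
        field_simp
    _ ≤ _ := by
        refine Real.rpow_le_rpow (by positivity) (by exact_mod_cast exponentNorm_pow_le N) ?_
        rw [sub_nonneg, div_le_one (by linarith)]
        exact hd

/-- A sum over the shell of a quantity that vanishes as one coordinate tends to infinity is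
negligible with respect to `N^(1 - 1/d)`. -/
theorem tendsto_sum_shell_div {ε : ℕ → ℝ} (hε : ∀ a, 0 ≤ ε a) (hε0 : Tendsto ε atTop (𝓝 0))
    (M : ℕ) (j : Fin d) : Tendsto (fun N : ℕ => 1 / (N : ℝ) ^ (1 - 1 / (d : ℝ)) *
      ∑ α ∈ shell d M (exponentNorm d N), ε (α j)) atTop (𝓝 0) := by
  have hlim : Tendsto (fun N => 2 ^ (d - 1) * (d * shellError ε M (exponentNorm d N))) atTop
      (𝓝 0) := by
    simpa using (((tendsto_shellError hε0 M).comp (tendsto_exponentNorm (d := d))).const_mul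
      (d : ℝ)).const_mul ((2 : ℝ) ^ (d - 1))
  refine squeeze_zero' (Eventually.of_forall fun N => ?_) ?_ hlim
  · have := Finset.sum_nonneg fun (α : Fin d → ℕ) (_ : α ∈ shell d M (exponentNorm d N)) =>
      hε (α j)
    positivity
  -- For `n ≥ 1` the surfaces `(n + 1)^(d - 1)` and `n^(d - 1)` are comparable.
  · filter_upwards [(tendsto_exponentNorm (d := d)).eventually_ge_atTop 1] with N hN
    have hN' : (1 : ℝ) ≤ exponentNorm d N := by exact_mod_cast hN
    have hpow := exponentNorm_pow_le_rpow (d := d) N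
    have hpos : (0 : ℝ) < (N : ℝ) ^ (1 - 1 / (d : ℝ)) :=
      lt_of_lt_of_le (by positivity) hpow
    have herr : 0 ≤ shellError ε M (exponentNorm d N) := by
      have h1 : 0 ≤ ∑ a ∈ Finset.Icc (exponentNorm d N - M) (exponentNorm d N), ε a :=
        Finset.sum_nonneg fun a _ => hε a
      have h2 : 0 ≤ ∑ a ∈ Finset.range (exponentNorm d N + 1), ε a :=
        Finset.sum_nonneg fun a _ => hε a
      rw [shellError]
      positivity
    rw [one_div, inv_mul_le_iff₀ hpos]
    calc _ ≤ d * (((exponentNorm d N : ℝ) + 1) ^ (d - 1) * shellError ε M (exponentNorm d N)) :=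
          sum_shell_le hε j
      _ ≤ d * ((2 * (exponentNorm d N : ℝ)) ^ (d - 1) * shellError ε M (exponentNorm d N)) := by
          gcongr
          linarith
      _ = (exponentNorm d N : ℝ) ^ (d - 1) *
          (2 ^ (d - 1) * (d * shellError ε M (exponentNorm d N))) := by
          rw [mul_pow]; ring
      _ ≤ _ := by gcongr

end InitialSegment

/-! ### Covariances for product measures -/

/-- Telescoping bound for the difference of two products of numbers in `[-1, 1]`. -/
theorem abs_prod_sub_prod_le {ι : Type*} (s : Finset ι) {a b : ι → ℝ} (ha : ∀ i, |a i| ≤ 1)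
    (hb : ∀ i, |b i| ≤ 1) : |∏ i ∈ s, a i - ∏ i ∈ s, b i| ≤ ∑ i ∈ s, |a i - b i| := by
  classical
  induction s using Finset.induction_on with
  | empty => simp
  | insert i s hi ih =>
    rw [Finset.prod_insert hi, Finset.prod_insert hi, Finset.sum_insert hi]
    have h1 : |∏ i ∈ s, a i| ≤ 1 := by
      rw [Finset.abs_prod]
      exact Finset.prod_le_one (fun i _ => abs_nonneg _) fun i _ => ha i
    calc |a i * ∏ i ∈ s, a i - b i * ∏ i ∈ s, b i|
        = |(a i - b i) * ∏ i ∈ s, a i + b i * (∏ i ∈ s, a i - ∏ i ∈ s, b i)| := by ring_nf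
      _ ≤ |a i - b i| * |∏ i ∈ s, a i| + |b i| * |∏ i ∈ s, a i - ∏ i ∈ s, b i| := by
        rw [← abs_mul, ← abs_mul]; exact abs_add_le _ _
      _ ≤ |a i - b i| * 1 + 1 * |∏ i ∈ s, a i - ∏ i ∈ s, b i| := by gcongr; exact hb i
      _ ≤ _ := by linarith

theorem linearStatistic_add {d : ℕ} (P Q : MvPolynomial (Fin d) ℝ) (N : ℕ) :
    linearStatistic (P + Q) N = linearStatistic P N + linearStatistic Q N := by
  ext x
  simp [linearStatistic, Finset.sum_add_distrib]

theorem linearStatistic_monomial {d : ℕ} (s : Fin d →₀ ℕ) (c : ℝ) (N : ℕ) :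
    linearStatistic (MvPolynomial.monomial s c) N =
      c • fun x : Fin N → Fin d → ℝ => ∑ i, ∏ j, x i j ^ s j := by
  ext x
  simp [linearStatistic, MvPolynomial.eval_monomial, Finsupp.prod_fintype, Finset.mul_sum]

section Product

variable {d : ℕ} {ν ν' : Fin d → Measure ℝ} {p p' : Fin d → ℕ → Polynomial ℝ}

/-- The multi-indices `β ∈ ℕ^d` at sup distance at most `M` from `α`. -/
def band (M : ℕ) (α : Fin d → ℕ) : Finset (Fin d → ℕ) :=
  Fintype.piFinset fun j => Finset.Icc (α j - M) (α j + M)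

theorem card_band_le (M : ℕ) (α : Fin d → ℕ) : (band M α).card ≤ (2 * M + 1) ^ d := by
  rw [band, Fintype.card_piFinset]
  calc ∏ j, (Finset.Icc (α j - M) (α j + M)).card ≤ ∏ _j : Fin d, (2 * M + 1) :=
        Finset.prod_le_prod' fun j _ => by rw [Nat.card_Icc]; omega
    _ = _ := by simp

/-- The product entry `⟨x^m φ_α, φ_β⟩ ⟨x^m' φ_α, φ_β⟩` for a product measure. -/
noncomputable def tensorProd (ν : Fin d → Measure ℝ) (p : Fin d → ℕ → Polynomial ℝ)
    (m m' α β : Fin d → ℕ) : ℝ := ∏ j, jacobiProd (ν j) (p j) (m j) (m' j) (α j) (β j)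

variable [NeZero d] [∀ j, IsProbabilityMeasure (ν j)] [∀ j, IsProbabilityMeasure (ν' j)]

theorem isCompactlyOrthonormal_multiOrthoPoly (hp : ∀ j, IsOrthonormalSystem (ν j) (p j)) :
    IsCompactlyOrthonormal (Measure.pi ν) (unitCube d) (multiOrthoPoly (Measure.pi ν)) where
  isCompact := isCompact_unitCube d
  compl_null := pi_unitCube_compl hp
  continuous k := by rw [multiOrthoPoly_pi hp]; fun_prop
  integral_mul i j := by
    simp_rw [multiOrthoPoly_pi hp, integral_tensorPoly_mul hp]
    simp

theorem matrixEntry_monomial (hp : ∀ j, IsOrthonormalSystem (ν j) (p j)) (m : Fin d → ℕ)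
    (k l : ℕ) : matrixEntry (Measure.pi ν) (multiOrthoPoly (Measure.pi ν))
      (fun x => ∏ j, x j ^ m j) k l =
        ∏ j, jacobiPow (ν j) (p j) (m j) (exponent d k j) (exponent d l j) := by
  rw [matrixEntry, multiOrthoPoly_pi hp, multiOrthoPoly_pi hp]
  exact integral_monomial_mul_tensorPoly m _ _

/-- The covariance of two monomial statistics as a boundary sum: one exponent is among the first
`N`, the other one is not, and the two are close to each other. -/
theorem covariance_monomial (hp : ∀ j, IsOrthonormalSystem (ν j) (p j)) {m m' : Fin d → ℕ} {M : ℕ}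
    (hM : ∀ j, m j ≤ M) (N : ℕ) :
    cov[fun x => ∑ i, ∏ j, x i j ^ m j, fun x => ∑ i, ∏ j, x i j ^ m' j;
      opEnsemble (Measure.pi ν) N] =
      ∑ α ∈ firstExponents d N, ∑ β ∈ band M α \ firstExponents d N, tensorProd ν p m m' α β := by
  refine (covariance_ensemble (isCompactlyOrthonormal_multiOrthoPoly hp) N
    (f := fun x => ∏ j, x j ^ m j) (g := fun x => ∏ j, x j ^ m' j)
    (by fun_prop) (by fun_prop)).trans ?_
  rw [firstExponents, Finset.sum_map]
  refine Finset.sum_congr rfl fun k _ => ?_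
  simp_rw [matrixEntry_monomial hp, ← Finset.prod_mul_distrib, ← pow_add, matrixEntry_monomial hp]
  rw [← firstExponents]
  obtain ⟨α, hα⟩ : ∃ α, exponent d k = α := ⟨_, rfl⟩
  -- Parseval's identity in each coordinate: the diagonal entry is the sum over the whole band, from
  -- which the sum over the first `N` exponents is subtracted.
  have h1 : ∏ j, jacobiPow (ν j) (p j) (m j + m' j) (exponent d k j) (exponent d k j) =
      ∑ β ∈ band M α, tensorProd ν p m m' α β := by
    rw [hα, Finset.prod_congr rfl fun j _ => (hp j).jacobiPow_diag_eq_sum (hM j) (m' j) (α j),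
      Finset.prod_univ_sum]
    rfl
  have h2 : ∑ l ∈ Finset.range N, ∏ j,
      jacobiPow (ν j) (p j) (m j) (exponent d k j) (exponent d l j) *
        jacobiPow (ν j) (p j) (m' j) (exponent d k j) (exponent d l j) =
      ∑ β ∈ band M α ∩ firstExponents d N, tensorProd ν p m m' α β := by
    trans ∑ β ∈ firstExponents d N, tensorProd ν p m m' α β
    · rw [firstExponents, Finset.sum_map, hα]
      rfl
    · symm
      refine Finset.sum_subset Finset.inter_subset_right fun β hβ hβ' => ?_
      have hβ'' : β ∉ band M α := fun h => hβ' (Finset.mem_inter.2 ⟨h, hβ⟩)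
      rw [band, Fintype.mem_piFinset, not_forall] at hβ''
      obtain ⟨j, hj⟩ := hβ''
      exact Finset.prod_eq_zero (Finset.mem_univ j) ((hp j).jacobiProd_eq_zero (hM j) hj)
  rw [h1, h2, sub_eq_iff_eq_add', ← hα]
  exact (Finset.sum_inter_add_sum_sdiff _ _ _).symm

/-- The difference of two covariances is carried by the shell, where it is controlled coordinate by
coordinate by the difference of the one-dimensional band rows. -/
theorem abs_covariance_monomial_sub_le (hp : ∀ j, IsOrthonormalSystem (ν j) (p j))
    (hp' : ∀ j, IsOrthonormalSystem (ν' j) (p' j)) {m m' : Fin d → ℕ} {M : ℕ}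
    (hM : ∀ j, m j ≤ M) (N : ℕ) :
    |cov[fun x => ∑ i, ∏ j, x i j ^ m j, fun x => ∑ i, ∏ j, x i j ^ m' j;
        opEnsemble (Measure.pi ν) N] -
      cov[fun x => ∑ i, ∏ j, x i j ^ m j, fun x => ∑ i, ∏ j, x i j ^ m' j;
        opEnsemble (Measure.pi ν') N]| ≤
      (2 * M + 1) ^ d * ∑ j, ∑ α ∈ shell d M (exponentNorm d N),
        jacobiRowDiff (ν j) (ν' j) (p j) (p' j) (m j) (m' j) M (α j) := by
  rw [covariance_monomial hp hM, covariance_monomial hp' hM, ← Finset.sum_sub_distrib]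
  simp_rw [← Finset.sum_sub_distrib]
  have hrow0 : ∀ j a, 0 ≤ jacobiRowDiff (ν j) (ν' j) (p j) (p' j) (m j) (m' j) M a :=
    fun j a => Finset.sum_nonneg fun _ _ => abs_nonneg _
  have hterm : ∀ α β, β ∈ band M α → |tensorProd ν p m m' α β - tensorProd ν' p' m m' α β| ≤
      ∑ j, jacobiRowDiff (ν j) (ν' j) (p j) (p' j) (m j) (m' j) M (α j) := by
    intro α β hβ
    refine (abs_prod_sub_prod_le _ (fun j => (hp j).abs_jacobiProd_le_one _ _ _ _)
      (fun j => (hp' j).abs_jacobiProd_le_one _ _ _ _)).trans (Finset.sum_le_sum fun j _ => ?_)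
    exact Finset.single_le_sum (f := fun l => |jacobiProd (ν j) (p j) (m j) (m' j) (α j) l -
      jacobiProd (ν' j) (p' j) (m j) (m' j) (α j) l|) (fun _ _ => abs_nonneg _)
      (Fintype.mem_piFinset.1 hβ j)
  have hin : ∀ α, |∑ β ∈ band M α \ firstExponents d N,
      (tensorProd ν p m m' α β - tensorProd ν' p' m m' α β)| ≤
      (2 * M + 1) ^ d * ∑ j, jacobiRowDiff (ν j) (ν' j) (p j) (p' j) (m j) (m' j) M (α j) := by
    intro α
    have hcard : ((band M α \ firstExponents d N).card : ℝ) ≤ (2 * M + 1) ^ d := by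
      exact_mod_cast (Finset.card_le_card Finset.sdiff_subset).trans (card_band_le M α)
    calc _ ≤ ∑ β ∈ band M α \ firstExponents d N,
          |tensorProd ν p m m' α β - tensorProd ν' p' m m' α β| := Finset.abs_sum_le_sum_abs _ _
      _ ≤ (band M α \ firstExponents d N).card •
          ∑ j, jacobiRowDiff (ν j) (ν' j) (p j) (p' j) (m j) (m' j) M (α j) :=
        Finset.sum_le_card_nsmul _ _ _ fun β hβ => hterm α β (Finset.mem_sdiff.1 hβ).1
      _ ≤ _ := by
        rw [nsmul_eq_mul]
        gcongr
        exact Finset.sum_nonneg fun j _ => hrow0 j _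
  -- Away from the shell, the whole band around `α` lies among the first `N` exponents.
  have hout : ∀ α ∈ firstExponents d N, α ∉ shell d M (exponentNorm d N) →
      band M α \ firstExponents d N = ∅ := by
    intro α hα hα'
    rw [Finset.sdiff_eq_empty_iff_subset]
    intro β hβ
    refine mem_firstExponents_of_lt fun j => ?_
    by_contra hj
    refine hα' (mem_shell (i := j) (le_exponentNorm_of_mem hα) ?_)
    have := (Finset.mem_Icc.1 (Fintype.mem_piFinset.1 hβ j)).2
    omega
  calc _ ≤ ∑ α ∈ firstExponents d N, |∑ β ∈ band M α \ firstExponents d N,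
        (tensorProd ν p m m' α β - tensorProd ν' p' m m' α β)| := Finset.abs_sum_le_sum_abs _ _
    _ ≤ ∑ α ∈ shell d M (exponentNorm d N), |∑ β ∈ band M α \ firstExponents d N,
        (tensorProd ν p m m' α β - tensorProd ν' p' m m' α β)| := by
      rw [← Finset.sum_filter_of_ne (p := fun α => α ∈ shell d M (exponentNorm d N))]
      · exact Finset.sum_le_sum_of_subset_of_nonneg
          (fun α hα => (Finset.mem_filter.1 hα).2) fun _ _ _ => abs_nonneg _
      · intro α hα hne
        by_contra hα'
        rw [hout α hα hα'] at hne
        simp at hne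
    _ ≤ ∑ α ∈ shell d M (exponentNorm d N), (2 * M + 1) ^ d *
        ∑ j, jacobiRowDiff (ν j) (ν' j) (p j) (p' j) (m j) (m' j) M (α j) :=
      Finset.sum_le_sum fun α _ => hin α
    _ = _ := by rw [← Finset.mul_sum, Finset.sum_comm]

/-- The covariances of monomials agree up to `o(N^(1 - 1/d))` for any two products of measures with
Nevai systems. -/
theorem tendsto_covariance_monomial_sub (hp : ∀ j, IsNevaiSystem (ν j) (p j))
    (hp' : ∀ j, IsNevaiSystem (ν' j) (p' j)) (m m' : Fin d → ℕ) :
    Tendsto (fun N : ℕ => 1 / (N : ℝ) ^ (1 - 1 / (d : ℝ)) *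
      (cov[fun x => ∑ i, ∏ j, x i j ^ m j, fun x => ∑ i, ∏ j, x i j ^ m' j;
        opEnsemble (Measure.pi ν) N] -
      cov[fun x => ∑ i, ∏ j, x i j ^ m j, fun x => ∑ i, ∏ j, x i j ^ m' j;
        opEnsemble (Measure.pi ν') N])) atTop (𝓝 0) := by
  set M := Finset.univ.sup m with hM
  have hMj : ∀ j, m j ≤ M := fun j => Finset.le_sup (Finset.mem_univ j)
  have hlim : Tendsto (fun N : ℕ => ((2 : ℝ) * M + 1) ^ d * ∑ j : Fin d,
      (1 / (N : ℝ) ^ (1 - 1 / (d : ℝ)) * ∑ α ∈ shell d M (exponentNorm d N),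
        jacobiRowDiff (ν j) (ν' j) (p j) (p' j) (m j) (m' j) M (α j))) atTop (𝓝 0) := by
    have := (tendsto_finsetSum (Finset.univ : Finset (Fin d)) fun j _ => tendsto_sum_shell_div
      (fun a => Finset.sum_nonneg fun _ _ => abs_nonneg _)
      (tendsto_jacobiRowDiff (hp j) (hp' j) (m j) (m' j) M) M j).const_mul (((2 : ℝ) * M + 1) ^ d)
    simpa [jacobiRowDiff] using this
  refine squeeze_zero_norm (fun N => ?_) hlim
  have hN : (0 : ℝ) ≤ 1 / (N : ℝ) ^ (1 - 1 / (d : ℝ)) := by positivity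
  rw [Real.norm_eq_abs, abs_mul, abs_of_nonneg hN, ← Finset.mul_sum, mul_left_comm]
  exact mul_le_mul_of_nonneg_left (abs_covariance_monomial_sub_le
    (fun j => (hp j).toIsOrthonormalSystem) (fun j => (hp' j).toIsOrthonormalSystem) hMj N) hN

theorem isProbabilityMeasure_opEnsemble (hp : ∀ j, IsOrthonormalSystem (ν j) (p j)) (N : ℕ) :
    IsProbabilityMeasure (opEnsemble (Measure.pi ν) N) :=
  isProbabilityMeasure_ensemble (isCompactlyOrthonormal_multiOrthoPoly hp) N

theorem memLp_linearStatistic (hp : ∀ j, IsOrthonormalSystem (ν j) (p j))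
    (P : MvPolynomial (Fin d) ℝ) (N : ℕ) :
    MemLp (linearStatistic P N) 2 (opEnsemble (Measure.pi ν) N) := by
  refine memLp_ensemble (isCompactlyOrthonormal_multiOrthoPoly hp) N ?_ 2
  unfold linearStatistic
  exact continuous_finsetSum _ fun i _ => (MvPolynomial.continuous_eval P).comp (continuous_apply i)

/-- By bilinearity of the covariance, it suffices to treat monomials. -/
theorem tendsto_covariance_sub (hp : ∀ j, IsNevaiSystem (ν j) (p j))
    (hp' : ∀ j, IsNevaiSystem (ν' j) (p' j)) (P Q : MvPolynomial (Fin d) ℝ) :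
    Tendsto (fun N : ℕ => 1 / (N : ℝ) ^ (1 - 1 / (d : ℝ)) *
      (cov[linearStatistic P N, linearStatistic Q N; opEnsemble (Measure.pi ν) N] -
        cov[linearStatistic P N, linearStatistic Q N; opEnsemble (Measure.pi ν') N]))
      atTop (𝓝 0) := by
  have hprob := isProbabilityMeasure_opEnsemble fun j => (hp j).toIsOrthonormalSystem
  have hprob' := isProbabilityMeasure_opEnsemble fun j => (hp' j).toIsOrthonormalSystem
  have hL := memLp_linearStatistic fun j => (hp j).toIsOrthonormalSystem
  have hL' := memLp_linearStatistic fun j => (hp' j).toIsOrthonormalSystem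
  induction P using MvPolynomial.induction_on' with
  | monomial s c =>
    induction Q using MvPolynomial.induction_on' with
    | monomial s' c' =>
      simp_rw [linearStatistic_monomial, covariance_smul_left, covariance_smul_right]
      have := (tendsto_covariance_monomial_sub hp hp' s s').const_mul (c * c')
      rw [mul_zero] at this
      refine this.congr fun N => ?_
      ring
    | add Q₁ Q₂ h₁ h₂ =>
      have := h₁.add h₂
      rw [add_zero] at this
      refine this.congr fun N => ?_
      rw [linearStatistic_add, covariance_add_right (hL _ N) (hL _ N) (hL _ N),
        covariance_add_right (hL' _ N) (hL' _ N) (hL' _ N)]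
      ring
  | add P₁ P₂ h₁ h₂ =>
    have := h₁.add h₂
    rw [add_zero] at this
    refine this.congr fun N => ?_
    rw [linearStatistic_add, covariance_add_left (hL _ N) (hL _ N) (hL _ N),
      covariance_add_left (hL' _ N) (hL' _ N) (hL' _ N)]
    ring

end Product

/-! ### Comparison with the equilibrium measure -/

theorem mainTheorem8 (d : ℕ) [NeZero d] (μ : Fin d → Measure ℝ)
    [∀ j, IsProbabilityMeasure (μ j)] (hμ : ∀ j, IsNevaiClass (μ j))
    (P Q : MvPolynomial (Fin d) ℝ) :
    (∀ ν ∈ ({Measure.pi μ, Measure.pi fun _ : Fin d => equilibriumMeasure} :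
        Set (Measure (Fin d → ℝ))), ∀ N : ℕ,
      IsProbabilityMeasure (opEnsemble ν N) ∧
      MemLp (linearStatistic P N) 2 (opEnsemble ν N) ∧
      MemLp (linearStatistic Q N) 2 (opEnsemble ν N)) ∧
    Tendsto
      (fun N : ℕ => 1 / (N : ℝ) ^ (1 - 1 / (d : ℝ)) *
        |cov[linearStatistic P N, linearStatistic Q N; opEnsemble (Measure.pi μ) N] -
          cov[linearStatistic P N, linearStatistic Q N;
            opEnsemble (Measure.pi fun _ : Fin d => equilibriumMeasure) N]|)
      atTop (𝓝 0) := by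
  choose p hp using fun j => (hμ j).exists_isNevaiSystem
  have hp' : ∀ _ : Fin d, IsNevaiSystem equilibriumMeasure chebyshevSystem :=
    fun _ => isNevaiSystem_chebyshevSystem
  have ho := fun j => (hp j).toIsOrthonormalSystem
  have ho' := fun j => (hp' j).toIsOrthonormalSystem
  refine ⟨?_, ?_⟩
  · rintro ν (rfl | rfl) N
    · exact ⟨isProbabilityMeasure_opEnsemble ho N, memLp_linearStatistic ho P N,
        memLp_linearStatistic ho Q N⟩
    · exact ⟨isProbabilityMeasure_opEnsemble ho' N, memLp_linearStatistic ho' P N,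
        memLp_linearStatistic ho' Q N⟩
  · have h := (tendsto_covariance_sub hp hp' P Q).abs
    rw [abs_zero] at h
    refine h.congr fun N => ?_
    have hN : (0 : ℝ) ≤ 1 / (N : ℝ) ^ (1 - 1 / (d : ℝ)) := by positivity
    rw [abs_mul, abs_of_nonneg hN]
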